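/- Let $\mathcal W:\mathrm{Hom}(\mathbb R^d,\mathbb R^d)\to(-\infty,\infty]$ be an archetype whose symmetry group $\mathcal G=\{g\in GL(d):\ \mathcal W(B\circ g)=\mathcal W(B)\ \text{for all } B\}$ is contained in $SO(d)$ (that is, $\mathcal W$ is solid and undistorted) and is discrete. A \emph{body with discrete defects} with archetype $\mathcal W$ is a smooth $d$-manifold $\mathcal M$ with a volume form $\mathrm{Vol}$ and an energy density $W$ that admits an open cover $(U_\alpha)_\alpha$ and smooth closed $\mathbb R^d$-valued one-forms $P_\alpha$ on $U_\alpha$ such that, for every $p\in U_\alpha$, $P_\alpha(p):T_p\mathcal M\to\mathbb R^d$ is an isomorphism, $\mathrm{Vol}_p=P_\alpha(p)^*dx$, and $W_p(A)=\mathcal W(A\circ P_\alpha(p)^{-1})$ for all $A\in \mathrm{Hom}(T_p\mathcal M,\mathbb R^d)$. Its intrinsic metric is $G_p(X,Y)=P_\alpha(p)X\cdot P_\alpha(p)Y$ for $p\in U_\alpha$ (independent of $\alpha$), and the \emph{disclination content} $c_\gamma:T_p\mathcal M\to T_p\mathcal M$ of a piecewise smooth closed curve $\gamma$ based at $p$ is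 the parallel transport along $\gamma$ of the Levi-Civita connection of $G$. Then: 1. There is $\varepsilon>0$, depending only on $\mathcal W$, such that for every body with discrete defects with archetype $\mathcal W$ and every piecewise smooth closed curve $\gamma$ in it, based at $p$, either $c_\gamma=\mathrm{Id}_{T_p\mathcal M}$, or $|P_\alpha(p)\circ c_\gamma\circ P_\alpha(p)^{-1}-\mathrm{Id}|\ge\varepsilon$ in operator norm for every $\alpha$ with $p\in U_\alpha$ (equivalently, the distance of $c_\gamma$ from the identity in the operator norm of $G_p$ is at least $\varepsilon$). 2. Let $\mathcal M$ be a smooth $d$-manifold and let $\mathcal M^n\subset\mathcal M$ $(n\in\mathbb N)$ be open subsets, each of which is the body manifold of a body with discrete defects with archetype $\mathcal W$, with Levi-Civita connection $\nabla^n$. Then $(\nabla^n)$ does not converge to any smooth affine connection $\nabla$ on $\mathcal M$ with non-vanishing curvature, for any notion of convergence that implies convergence of parallel transport in the following sense: for every piecewise smooth closed curve $\gamma:[0,1]\to\mathcal M$ there are piecewise smooth closed curves $\gamma_n:[0,1]\to\mathcal M^n$ (for all sufficiently large $n$) that converge uniformly to $\gamma$, and for which the parallel transport of $\nabla^n$ along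 $\gamma_n$ converges, in the bundle $\mathrm{End}(T\mathcal M)$, to the parallel transport of $\nabla$ along $\gamma$. -/

import Mathlib

open Set Filter Topology Bundle
open scoped Manifold ContDiff

universe u w

namespace DiscreteDefects

/-- Euclidean space `ℝ^d`. -/
abbrev Euc (d : ℕ) : Type := EuclideanSpace ℝ (Fin d)

/-! ### Archetypes and their symmetry groups -/

/-- An archetype: an energy density on the linear maps of `ℝ^d`, with values in `(-∞, ∞]`. -/
abbrev Archetype (d : ℕ) : Type := (Euc d →L[ℝ] Euc d) → WithTop ℝ

/-- The symmetry group of an archetype: all `g ∈ GL(d)` with `𝒲 (B ∘ g) = 𝒲 B` for every `B`. It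
carries the topology of `GL(d)`. -/
def symmetryGroup {d : ℕ} (𝒲 : Archetype d) : Subgroup (Euc d →L[ℝ] Euc d)ˣ where
  carrier := {g | ∀ B : Euc d →L[ℝ] Euc d, 𝒲 (B ∘L (g : Euc d →L[ℝ] Euc d)) = 𝒲 B}
  mul_mem' := by
    intro g h hg hh B
    have h1 := hh (B ∘L (g : Euc d →L[ℝ] Euc d))
    rw [hg B] at h1
    exact h1
  one_mem' := fun B => rfl
  inv_mem' := by
    intro g hg B
    have h1 := hg (B ∘L ((g⁻¹ : (Euc d →L[ℝ] Euc d)ˣ) : Euc d →L[ℝ] Euc d))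
    have h2 : (B ∘L ((g⁻¹ : (Euc d →L[ℝ] Euc d)ˣ) : Euc d →L[ℝ] Euc d)) ∘L
        (g : Euc d →L[ℝ] Euc d) = B := by
      rw [ContinuousLinearMap.comp_assoc]
      have h3 : ((g⁻¹ : (Euc d →L[ℝ] Euc d)ˣ) : Euc d →L[ℝ] Euc d) ∘L
          (g : Euc d →L[ℝ] Euc d) = ContinuousLinearMap.id ℝ (Euc d) := g.inv_mul
      rw [h3, ContinuousLinearMap.comp_id]
    rw [h2] at h1
    exact h1.symm

/-- The elements of `SO(d)`: linear isometries of `ℝ^d` with determinant one. -/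
def IsRotation {d : ℕ} (g : Euc d →L[ℝ] Euc d) : Prop :=
  (∀ v, ‖g v‖ = ‖v‖) ∧ g.det = 1

/-- A (solid) undistorted archetype: the symmetry group is contained in `SO(d)`. -/
def IsUndistorted {d : ℕ} (𝒲 : Archetype d) : Prop :=
  ∀ g ∈ symmetryGroup 𝒲, IsRotation (g : Euc d →L[ℝ] Euc d)

/-! ### Bodies -/

section Bodies

variable (d : ℕ) (M : Type u) [TopologicalSpace M] [ChartedSpace (Euc d) M]
  [IsManifold (𝓡 d) ∞ M]

/-- A hyperelastic body whose body manifold is an open submanifold `carrier` of `M` (all of `M` for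
a body with body manifold `M`). The volume form `vol` fixes the orientation. The values of `W` and
`vol` outside `carrier` are irrelevant. -/
structure HyperelasticBody where
  /-- the body manifold -/
  carrier : Set M
  isOpen_carrier : IsOpen carrier
  /-- the energy density (constitutive relation) -/
  W : (p : M) → (TangentSpace (𝓡 d) p →L[ℝ] Euc d) → WithTop ℝ
  /-- the volume form -/
  vol : (p : M) → (TangentSpace (𝓡 d) p) [⋀^Fin d]→ₗ[ℝ] ℝ
  vol_smooth : ∀ X : Fin d → (p : M) → TangentSpace (𝓡 d) p,
    (∀ i, ContMDiffOn (𝓡 d) (𝓡 d).tangent ∞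
      (fun p => (⟨p, X i p⟩ : TangentBundle (𝓡 d) M)) carrier) →
    ContMDiffOn (𝓡 d) 𝓘(ℝ, ℝ) ∞ (fun p => vol p (fun i => X i p)) carrier
  vol_ne_zero : ∀ p ∈ carrier, vol p ≠ 0

variable {d}

/-- A hyperelastic smooth uniform body with archetype `𝒲`, together with a lattice structure: an
open cover `U α` of the body manifold and smooth `ℝ^d`-valued one-forms `P α` on `U α`. -/
structure UniformBody (𝒲 : Archetype d) extends HyperelasticBody d M where
  /-- the index set of the lattice structure -/
  ι : Type w
  /-- the reference neighborhoods -/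
  U : ι → Set M
  isOpen_U : ∀ α, IsOpen (U α)
  iUnion_U : ⋃ α, U α = carrier
  /-- the reference maps -/
  P : ι → (p : M) → TangentSpace (𝓡 d) p →L[ℝ] Euc d
  P_smooth : ∀ α, ContMDiffOn (𝓡 d) ((𝓡 d).prod 𝓘(ℝ, Euc d →L[ℝ] Euc d)) ∞
    (fun p => (TotalSpace.mk' (Euc d →L[ℝ] Euc d) p (P α p) :
      TotalSpace (Euc d →L[ℝ] Euc d)
        (fun q : M => TangentSpace (𝓡 d) q →L[ℝ] Bundle.Trivial M (Euc d) q))) (U α)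
  P_invertible : ∀ α, ∀ p ∈ U α, (P α p).IsInvertible
  /-- `Vol = (P α)^* dx` -/
  vol_eq : ∀ α, ∀ p ∈ U α, ∀ v : Fin d → TangentSpace (𝓡 d) p,
    vol p v = (EuclideanSpace.basisFun (Fin d) ℝ).toBasis.det (fun i => P α p (v i))
  /-- `W_p (A) = 𝒲 (A ∘ (P α p)⁻¹)` -/
  W_eq : ∀ α, ∀ p ∈ U α, ∀ A : TangentSpace (𝓡 d) p →L[ℝ] Euc d,
    W p A = 𝒲 (A ∘L (P α p).inverse)

variable {M}

/-- An `ℝ^d`-valued one-form `P` is closed on the open set `U`: its exterior derivative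
`dP (X, Y) = X (P Y) - Y (P X) - P [X, Y]` vanishes at the points of `U`. -/
def IsClosedFormOn (P : (p : M) → TangentSpace (𝓡 d) p →L[ℝ] Euc d) (U : Set M) : Prop :=
  ∀ p ∈ U, ∀ X Y : (q : M) → TangentSpace (𝓡 d) q,
    MDifferentiableAt (𝓡 d) (𝓡 d).tangent (fun q => (⟨q, X q⟩ : TangentBundle (𝓡 d) M)) p →
    MDifferentiableAt (𝓡 d) (𝓡 d).tangent (fun q => (⟨q, Y q⟩ : TangentBundle (𝓡 d) M)) p →
    mvfderiv (𝓡 d) (fun q => P q (Y q)) p (X p) - mvfderiv (𝓡 d) (fun q => P q (X q)) p (Y p)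
      - P p (VectorField.mlieBracket (𝓡 d) X Y p) = 0

variable (M) in
/-- A body with discrete defects: a uniform body whose reference maps are closed one-forms. -/
structure DefectBody (𝒲 : Archetype d) extends UniformBody.{u, w} M 𝒲 where
  P_closed : ∀ α, IsClosedFormOn (P α) (U α)

open Classical in
/-- The intrinsic Riemannian metric `G_p (X, Y) = P α p X ⋅ P α p Y`, `p ∈ U α`, of a uniform body;
see `UniformBody.metric_eq` for its independence of `α`. -/
noncomputable def UniformBody.metric {𝒲 : Archetype d} (B : UniformBody.{u, w} M 𝒲)
    (p : M) (X Y : TangentSpace (𝓡 d) p) : ℝ :=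
  if h : ∃ α, p ∈ B.U α then inner ℝ (B.P h.choose p X) (B.P h.choose p Y) else 0

theorem UniformBody.metric_eq {𝒲 : Archetype d} (B : UniformBody.{u, w} M 𝒲)
    (h𝒲 : IsUndistorted 𝒲) {α : B.ι} {p : M} (hp : p ∈ B.U α) (X Y : TangentSpace (𝓡 d) p) :
    B.metric p X Y = inner ℝ (B.P α p X) (B.P α p Y) := by
  have h : ∃ α, p ∈ B.U α := ⟨α, hp⟩
  rw [UniformBody.metric, dif_pos h]
  obtain ⟨e, he⟩ := B.P_invertible α p hp
  obtain ⟨f, hf⟩ := B.P_invertible h.choose p h.choose_spec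
  have h1 := B.W_eq α p hp
  have h2 := B.W_eq h.choose p h.choose_spec
  rw [← he] at h1 ⊢
  rw [← hf] at h2 ⊢
  rw [ContinuousLinearMap.inverse_equiv] at h1 h2
  let g : (Euc d →L[ℝ] Euc d)ˣ := ContinuousLinearEquiv.unitsEquiv ℝ (Euc d) |>.symm (f.symm.trans e)
  have hg : g ∈ symmetryGroup 𝒲 := by
    intro C
    have h3 := h1 (C ∘L (e : TangentSpace (𝓡 d) p →L[ℝ] Euc d))
    have h4 := h2 (C ∘L (e : TangentSpace (𝓡 d) p →L[ℝ] Euc d))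
    rw [h3] at h4
    have h5 : (C ∘L (e : TangentSpace (𝓡 d) p →L[ℝ] Euc d)) ∘L
        (e.symm : Euc d →L[ℝ] TangentSpace (𝓡 d) p) = C := by
      ext v i
      simp
    rw [h5] at h4
    exact h4.symm
  have hi := (h𝒲 g hg).1
  have hgv : ∀ v : TangentSpace (𝓡 d) p, (g : Euc d →L[ℝ] Euc d) (f v) = e v := by
    intro v
    show e (f.symm (f v)) = e v
    simp
  let L : Euc d →ₗᵢ[ℝ] Euc d := ⟨(g : Euc d →L[ℝ] Euc d).toLinearMap, hi⟩
  have h6 := L.inner_map_map (f X) (f Y)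
  have h7 : ∀ v, L (f v) = e v := hgv
  rw [h7, h7] at h6
  exact h6.symm

end Bodies

/-! ### Connections, parallel transport, curvature -/

section Connections

variable (d : ℕ) (M : Type u) [TopologicalSpace M] [ChartedSpace (Euc d) M]

/-- The operator `σ ↦ ∇ σ` of an affine connection, where `∇ σ x v` stands for `(∇_v σ)(x)`. It is a
connection on `U` if it satisfies `IsCovariantDerivativeOn (Euc d) ∇ U`. -/
abbrev Conn : Type u :=
  ((x : M) → TangentSpace (𝓡 d) x) →
    ((x : M) → TangentSpace (𝓡 d) x →L[ℝ] TangentSpace (𝓡 d) x)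

variable {d M} [IsManifold (𝓡 d) ∞ M]

/-- `D` is the Levi-Civita connection of the intrinsic metric of the body `B`, on the body manifold:
it is a torsion-free connection there, and compatible with the metric. -/
structure UniformBody.IsLeviCivita {𝒲 : Archetype d} (B : UniformBody.{u, w} M 𝒲)
    (D : Conn d M) : Prop where
  isCovariantDerivativeOn : IsCovariantDerivativeOn (Euc d) D B.carrier
  torsion_free : ∀ p ∈ B.carrier, ∀ X Y : (q : M) → TangentSpace (𝓡 d) q,
    MDifferentiableAt (𝓡 d) (𝓡 d).tangent (fun q => (⟨q, X q⟩ : TangentBundle (𝓡 d) M)) p →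
    MDifferentiableAt (𝓡 d) (𝓡 d).tangent (fun q => (⟨q, Y q⟩ : TangentBundle (𝓡 d) M)) p →
    D Y p (X p) - D X p (Y p) = VectorField.mlieBracket (𝓡 d) X Y p
  metric_compatible : ∀ p ∈ B.carrier, ∀ (v : TangentSpace (𝓡 d) p)
    (X Y : (q : M) → TangentSpace (𝓡 d) q),
    MDifferentiableAt (𝓡 d) (𝓡 d).tangent (fun q => (⟨q, X q⟩ : TangentBundle (𝓡 d) M)) p →
    MDifferentiableAt (𝓡 d) (𝓡 d).tangent (fun q => (⟨q, Y q⟩ : TangentBundle (𝓡 d) M)) p →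
    mvfderiv (𝓡 d) (fun q => B.metric q (X q) (Y q)) p v
      = B.metric p (D X p v) (Y p) + B.metric p (X p) (D Y p v)

/-- `Q` holds on each interval of some subdivision of `[0, 1]`. -/
def Piecewise (Q : Set ℝ → Prop) : Prop :=
  ∃ (k : ℕ) (t : ℕ → ℝ), t 0 = 0 ∧ t k = 1 ∧
    ∀ i < k, t i < t (i + 1) ∧ Q (Icc (t i) (t (i + 1)))

variable (d) in
/-- `γ` restricts to a piecewise smooth closed curve `[0, 1] → M` based at `p`. -/
def IsClosedCurve (γ : ℝ → M) (p : M) : Prop :=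
  γ 0 = p ∧ γ 1 = p ∧ Piecewise (fun J => ContMDiffOn 𝓘(ℝ, ℝ) (𝓡 d) ∞ γ J)

/-- The vector field `V` along the curve `γ t = (V t).proj` is parallel on the interval `J`, where
`γ` is smooth. In the trivialization of `TM` given by the chart at `γ t` the equation
`∇_{γ'} V = 0` reads `v' = - ∇_{γ'} s`, where `v` is the representative of `V` and `s` is the local
vector field with constant representative `v t`. -/
def IsParallelOn (D : Conn d M) (V : ℝ → TangentBundle (𝓡 d) M) (J : Set ℝ) : Prop :=
  ContMDiffOn 𝓘(ℝ, ℝ) (𝓡 d) ∞ (fun τ => (V τ).proj) J ∧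
  ∀ t ∈ J, HasDerivWithinAt
    (fun τ => (trivializationAt (Euc d) (TangentSpace (𝓡 d)) (V t).proj (V τ)).2)
    (- D (fun x => (trivializationAt (Euc d) (TangentSpace (𝓡 d)) (V t).proj).symm x (V t).snd)
        (V t).proj (mfderivWithin 𝓘(ℝ, ℝ) (𝓡 d) (fun τ => (V τ).proj) J t (1 : ℝ)) : Euc d) J t

/-- `h : T_pM → T_qM` is the parallel transport of `D` along the piecewise smooth curve
`γ : [0, 1] → M` from `p` to `q`: every `v ∈ T_pM` extends to a parallel field along `γ` that ends
in `h v`. -/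
def IsParallelTransport (D : Conn d M) (γ : ℝ → M) {p q : M}
    (h : TangentSpace (𝓡 d) p →L[ℝ] TangentSpace (𝓡 d) q) : Prop :=
  ∀ v : TangentSpace (𝓡 d) p, ∃ V : ℝ → TangentBundle (𝓡 d) M,
    (∀ t ∈ Icc (0 : ℝ) 1, (V t).proj = γ t) ∧ V 0 = ⟨p, v⟩ ∧ V 1 = ⟨q, h v⟩ ∧
    Piecewise (IsParallelOn D V)

/-- `c` is the disclination content of the closed curve `γ` in the body `B`, based at `p`: the
holonomy along `γ` of the Levi-Civita connection of `B`. -/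
def DefectBody.IsDisclinationContent {𝒲 : Archetype d} (B : DefectBody.{u, w} M 𝒲)
    (γ : ℝ → M) {p : M} (c : TangentSpace (𝓡 d) p →L[ℝ] TangentSpace (𝓡 d) p) : Prop :=
  IsClosedCurve d γ p ∧ MapsTo γ (Icc 0 1) B.carrier ∧
    ∃ D : Conn d M, B.IsLeviCivita D ∧ IsParallelTransport D γ c

/-- The curvature `R(X, Y) Z = ∇_X ∇_Y Z - ∇_Y ∇_X Z - ∇_[X, Y] Z`. -/
noncomputable def curvature (D : Conn d M) (X Y Z : (x : M) → TangentSpace (𝓡 d) x) (p : M) :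
    TangentSpace (𝓡 d) p :=
  D (fun q => D Z q (Y q)) p (X p) - D (fun q => D Z q (X q)) p (Y p)
    - D Z p (VectorField.mlieBracket (𝓡 d) X Y p)

/-- A connection on `M` is flat if its curvature vanishes on smooth vector fields. -/
def IsFlat (D : Conn d M) : Prop :=
  ∀ X Y Z : (x : M) → TangentSpace (𝓡 d) x,
    ContMDiff (𝓡 d) (𝓡 d).tangent ∞ (fun q => (⟨q, X q⟩ : TangentBundle (𝓡 d) M)) →
    ContMDiff (𝓡 d) (𝓡 d).tangent ∞ (fun q => (⟨q, Y q⟩ : TangentBundle (𝓡 d) M)) →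
    ContMDiff (𝓡 d) (𝓡 d).tangent ∞ (fun q => (⟨q, Z q⟩ : TangentBundle (𝓡 d) M)) →
    ∀ p, curvature D X Y Z p = 0

/-- Convergence of the parallel transport of connections `D n`, given on open sets `N n` of `M`, to
that of a connection `D'` on `M`: every closed curve `γ` of `M` is a uniform limit of closed curves
`γ' n` of `N n` such that the parallel transport of `D n` along `γ' n` converges, in the bundle of
endomorphisms of `TM`, to the parallel transport of `D'` along `γ`. (One may take `γ' n = γ` if `γ`
lies in `N n`; in general `γ` may run through the defects. Uniform convergence is expressed as
continuous convergence.) -/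
def ParallelTransportConverges (N : ℕ → Set M) (D : ℕ → Conn d M) (D' : Conn d M) : Prop :=
  ∀ (γ : ℝ → M) (p : M), IsClosedCurve d γ p →
    ∃ (h : TangentSpace (𝓡 d) p →L[ℝ] TangentSpace (𝓡 d) p) (γ' : ℕ → ℝ → M) (p' : ℕ → M)
      (h' : (n : ℕ) → TangentSpace (𝓡 d) (p' n) →L[ℝ] TangentSpace (𝓡 d) (p' n)),
      IsParallelTransport D' γ h ∧
      (∀ᶠ n in atTop, IsClosedCurve d (γ' n) (p' n) ∧ MapsTo (γ' n) (Icc 0 1) (N n) ∧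
        IsParallelTransport (D n) (γ' n) (h' n)) ∧
      (∀ t ∈ Icc (0 : ℝ) 1,
        Tendsto (fun x : ℕ × ℝ => γ' x.1 x.2) (atTop ×ˢ 𝓝[Icc 0 1] t) (𝓝 (γ t))) ∧
      Tendsto (fun n => (TotalSpace.mk' (Euc d →L[ℝ] Euc d) (p' n) (h' n) :
          TotalSpace (Euc d →L[ℝ] Euc d)
            (fun x : M => TangentSpace (𝓡 d) x →L[ℝ] TangentSpace (𝓡 d) x))) atTop
        (𝓝 (TotalSpace.mk' (Euc d →L[ℝ] Euc d) p h))

end Connections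

end DiscreteDefects

/-!
The forms `P α` are closed and isometric for the intrinsic metric, so the fundamental lemma of
Riemannian geometry makes them parallel for the Levi-Civita connection. Two of them differ by a
locally constant element of the symmetry group `𝒢`; hence the holonomy along a closed curve is
conjugate, through any `P α p`, to an element of `𝒢`. A discrete group of linear isometries of `ℝ^d`
is finite, so its non-trivial elements stay away from the identity, which is the gap, and it has an
exponent `N ≠ 0`. The equation `h ^ N = 1` is closed in the bundle of endomorphisms of `TM` and
therefore passes to the holonomies of a limit connection. The holonomy along a loop of size `s`
with tangent plane spanned by `x` and `y` is `1 - (s² / 60) R(x, y) + o(s²)`, and `h ^ N = 1` then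
forces `R(x, y) = 0`.
-/

namespace DiscreteDefects

section Subdivisions

theorem exists_mem_Ico_of_mem_Ico {α : Type*} [LinearOrder α] {τ : ℕ → α} {x : α} {k : ℕ}
    (hx : x ∈ Ico (τ 0) (τ k)) : ∃ i < k, x ∈ Ico (τ i) (τ (i + 1)) := by
  induction k with
  | zero => exact absurd hx.2 (not_lt.2 hx.1)
  | succ k ih =>
    rcases lt_or_ge x (τ k) with hlt | hge
    · obtain ⟨i, hi, hxi⟩ := ih ⟨hx.1, hlt⟩
      exact ⟨i, hi.trans k.lt_succ_self, hxi⟩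
    · exact ⟨k, k.lt_succ_self, hge, hx.2⟩

theorem exists_mem_Ioc_of_mem_Ioc {α : Type*} [LinearOrder α] {τ : ℕ → α} {x : α} {k : ℕ}
    (hx : x ∈ Ioc (τ 0) (τ k)) : ∃ i < k, x ∈ Ioc (τ i) (τ (i + 1)) := by
  induction k with
  | zero => exact absurd hx.1 (not_lt.2 hx.2)
  | succ k ih =>
    rcases le_or_gt x (τ k) with hle | hgt
    · obtain ⟨i, hi, hxi⟩ := ih ⟨hx.1, hle⟩
      exact ⟨i, hi.trans k.lt_succ_self, hxi⟩
    · exact ⟨k, k.lt_succ_self, hgt, hx.2⟩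

namespace Piecewise

variable {Q : Set ℝ → Prop}

theorem exists_mem_Ico (h : Piecewise Q) {t : ℝ} (ht : t ∈ Ico (0 : ℝ) 1) :
    ∃ c d, Q (Icc c d) ∧ t ∈ Ico c d := by
  obtain ⟨k, τ, h_start, h_end, hQ⟩ := h
  rw [← h_start, ← h_end] at ht
  obtain ⟨i, hi, hti⟩ := exists_mem_Ico_of_mem_Ico ht
  exact ⟨τ i, τ (i + 1), (hQ i hi).2, hti⟩

theorem exists_mem_Ioc (h : Piecewise Q) {t : ℝ} (ht : t ∈ Ioc (0 : ℝ) 1) :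
    ∃ c d, Q (Icc c d) ∧ t ∈ Ioc c d := by
  obtain ⟨k, τ, h_start, h_end, hQ⟩ := h
  rw [← h_start, ← h_end] at ht
  obtain ⟨i, hi, hti⟩ := exists_mem_Ioc_of_mem_Ioc ht
  exact ⟨τ i, τ (i + 1), (hQ i hi).2, hti⟩

theorem continuousOn {X : Type*} [TopologicalSpace X] (h : Piecewise Q) {f : ℝ → X} {a b : ℝ}
    (ha : 0 ≤ a) (hb : b ≤ 1)
    (hf : ∀ c d, c < d → Q (Icc c d) → ∀ t ∈ Icc c d, t ∈ Icc a b →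
      ContinuousWithinAt f (Icc c d) t) :
    ContinuousOn f (Icc a b) := by
  intro t ht
  have left : ContinuousWithinAt f (Icc a t) t := by
    rcases ht.1.eq_or_lt with rfl | hat
    · simpa only [Icc_self] using continuousWithinAt_singleton
    obtain ⟨c, d, hQ, htcd⟩ := h.exists_mem_Ioc ⟨ha.trans_lt hat, ht.2.trans hb⟩
    refine (hf c d (htcd.1.trans_le htcd.2) hQ t (Ioc_subset_Icc_self htcd)
      ht).mono_of_mem_nhdsWithin ?_
    exact nhdsWithin_mono t Icc_subset_Iic_self (Icc_mem_nhdsLE_of_mem htcd)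
  have right : ContinuousWithinAt f (Icc t b) t := by
    rcases ht.2.eq_or_lt with rfl | htb
    · simpa only [Icc_self] using continuousWithinAt_singleton
    obtain ⟨c, d, hQ, htcd⟩ := h.exists_mem_Ico ⟨ha.trans ht.1, htb.trans_le hb⟩
    refine (hf c d (htcd.1.trans_lt htcd.2) hQ t (Ico_subset_Icc_self htcd)
      ht).mono_of_mem_nhdsWithin ?_
    exact nhdsWithin_mono t Icc_subset_Ici_self (Icc_mem_nhdsGE_of_mem htcd)
  rw [← Icc_union_Icc_eq_Icc ht.1 ht.2]
  exact left.union right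

theorem hasDerivWithinAt_Ici {E : Type*} [NormedAddCommGroup E] [NormedSpace ℝ E]
    (h : Piecewise Q) {f : ℝ → E} {f' : E} {t : ℝ} (ht : t ∈ Ico (0 : ℝ) 1)
    (hf : ∀ c d, c < d → Q (Icc c d) → t ∈ Icc c d → HasDerivWithinAt f f' (Icc c d) t) :
    HasDerivWithinAt f f' (Ici t) t := by
  obtain ⟨c, d, hQ, htcd⟩ := h.exists_mem_Ico ht
  exact (hf c d (htcd.1.trans_lt htcd.2) hQ (Ico_subset_Icc_self htcd)).mono_of_mem_nhdsWithin
    (Icc_mem_nhdsGE_of_mem htcd)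

theorem and_subset_unitInterval (h : Piecewise Q) :
    Piecewise fun J => J ⊆ Icc 0 1 ∧ Q J := by
  obtain ⟨k, τ, h_start, h_end, hτ⟩ := h
  have h_mono : MonotoneOn τ (Icc 0 k) := by
    refine (strictMonoOn_of_lt_add_one ordConnected_Icc fun i _ _ hi => ?_).monotoneOn
    exact (hτ i (Nat.lt_of_succ_le hi.2)).1
  refine ⟨k, τ, h_start, h_end, fun i hi => ⟨(hτ i hi).1, ?_, (hτ i hi).2⟩⟩
  refine Icc_subset_Icc (h_start ▸ ?_) (h_end ▸ ?_)
  · exact h_mono ⟨le_rfl, k.zero_le⟩ ⟨i.zero_le, hi.le⟩ i.zero_le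
  · exact h_mono ⟨Nat.zero_le _, hi⟩ ⟨k.zero_le, le_rfl⟩ hi

end Piecewise

end Subdivisions

section DiscreteGroups

theorem exists_forall_le_norm_val_sub_one {R : Type*} [NormedRing R] [HasSummableGeomSeries R]
    (G : Subgroup Rˣ) [DiscreteTopology G] :
    ∃ ε : ℝ, 0 < ε ∧ ∀ g ∈ G, g = 1 ∨ ε ≤ ‖(g : R) - 1‖ := by
  have one_isolated : {(1 : G)} ∈ 𝓝 (1 : G) := (isOpen_discrete _).mem_nhds rfl
  obtain ⟨s, hs, hsG⟩ := mem_nhds_subtype_iff_nhdsWithin.1 one_isolated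
    |> mem_nhdsWithin_iff_exists_mem_nhds_inter.1
  obtain ⟨ε, hε, hball⟩ := Metric.mem_nhds_iff.1
    (Units.isOpenEmbedding_val.isOpenMap.image_mem_nhds hs)
  refine ⟨ε, hε, fun g hg => or_iff_not_imp_right.2 fun hlt => ?_⟩
  obtain ⟨k, hks, hkg⟩ := hball (mem_ball_iff_norm.2 (not_le.1 hlt))
  rw [Units.ext hkg] at hks
  obtain ⟨x, rfl, hxg⟩ := hsG ⟨hks, hg⟩
  exact hxg.symm

theorem finite_of_le_units_of_isCompact {R : Type*} [Monoid R] [TopologicalSpace R] [T2Space R]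
    [ContinuousMul R] {G : Subgroup Rˣ} [DiscreteTopology G] {S : Submonoid R}
    (hS : IsCompact (S : Set R)) (hG : G ≤ S.units) : Finite G :=
  (S.units_isCompact hS).of_isClosed_subset Subgroup.isClosed_of_discrete hG
    |>.finite (isDiscrete_iff_discreteTopology.2 ‹_›)

theorem exists_pow_eq_one_of_isometry {E : Type*} [NormedAddCommGroup E] [NormedSpace ℝ E]
    [FiniteDimensional ℝ E] {G : Subgroup (E →L[ℝ] E)ˣ} [DiscreteTopology G]
    (hG : ∀ g ∈ G, ∀ v, ‖(g : E →L[ℝ] E) v‖ = ‖v‖) : ∃ N ≠ 0, ∀ g ∈ G, g ^ N = 1 := by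
  let contractions : Submonoid (E →L[ℝ] E) :=
    { carrier := Metric.closedBall 0 1
      one_mem' := mem_closedBall_zero_iff.2 ContinuousLinearMap.norm_id_le
      mul_mem' := fun {f g} hf hg => by
        rw [mem_closedBall_zero_iff] at *
        exact (norm_mul_le f g).trans (mul_le_one₀ hf (norm_nonneg _) hg) }
  have norm_le_one : ∀ g ∈ G, (g : E →L[ℝ] E) ∈ contractions := fun g hg =>
    mem_closedBall_zero_iff.2 <| ContinuousLinearMap.opNorm_le_bound _ zero_le_one fun v => by
      rw [one_mul, hG g hg]
  have : Finite G := finite_of_le_units_of_isCompact (S := contractions)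
    (isCompact_closedBall 0 1) fun g hg =>
      ⟨norm_le_one g hg, norm_le_one g⁻¹ (inv_mem hg)⟩
  refine ⟨Nat.card G, Nat.card_pos.ne', fun g hg => ?_⟩
  exact congrArg Subtype.val (pow_card_eq_one' (x := (⟨g, hg⟩ : G)))

theorem eq_zero_of_pow_eq_one_of_isLittleO {ι A : Type*} [NormedRing A] [NormedAlgebra ℝ A]
    {l : Filter ι} [l.NeBot] {H : ι → A} {F : A} {r : ι → ℝ} {N : ℕ} (hN : N ≠ 0)
    (hr : Tendsto r l (𝓝[≠] 0)) (hH : ∀ᶠ i in l, H i ^ N = 1)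
    (hF : (fun i => H i - 1 - r i • F) =o[l] r) : F = 0 := by
  obtain ⟨hr_zero, hr_ne⟩ := tendsto_nhdsWithin_iff.1 hr
  have slope : Tendsto (fun i => (r i)⁻¹ • (H i - 1)) l (𝓝 F) := by
    rw [← tendsto_sub_nhds_zero_iff]
    refine hF.tendsto_inv_smul_nhds_zero.congr' (hr_ne.mono fun i hi => ?_)
    rw [smul_sub, inv_smul_smul₀ hi]
  have H_tendsto : Tendsto H l (𝓝 1) := by
    have := (hr_zero.smul slope).add_const (1 : A)
    rw [zero_smul, zero_add] at this
    refine this.congr' (hr_ne.mono fun i hi => ?_)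
    rw [smul_inv_smul₀ hi, sub_add_cancel]
  -- `(∑ k < N, H ^ k) * (H - 1) = H ^ N - 1` vanishes, while its leading term is `r * (N * F)`.
  have geom_sum : Tendsto (fun i => (∑ k ∈ Finset.range N, H i ^ k) * ((r i)⁻¹ • (H i - 1))) l
      (𝓝 ((∑ k ∈ Finset.range N, (1 : A) ^ k) * F)) :=
    (tendsto_finsetSum _ fun k _ => H_tendsto.pow k).mul slope
  have geom_sum_eq_zero :
      ∀ᶠ i in l, (∑ k ∈ Finset.range N, H i ^ k) * ((r i)⁻¹ • (H i - 1)) = 0 := by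
    filter_upwards [hH] with i hi
    rw [mul_smul_comm, geom_sum_mul, hi, sub_self, smul_zero]
  have N_smul : (N : ℝ) • F = 0 := by
    simpa [Nat.cast_smul_eq_nsmul] using
      tendsto_nhds_unique (geom_sum.congr' geom_sum_eq_zero) tendsto_const_nhds
  exact (smul_eq_zero.1 N_smul).resolve_left (Nat.cast_ne_zero.2 hN)

end DiscreteGroups

section RightDerivatives

open Asymptotics

variable {E F : Type*} [NormedAddCommGroup E] [NormedSpace ℝ E] [NormedAddCommGroup F]
  [NormedSpace ℝ F]

/-- `f` is continuous on `[a, b]` with right derivative `f'`. This is what survives of a derivative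
along a piecewise smooth curve, and it suffices for the mean value and Grönwall inequalities. -/
def HasRightDerivOnIcc (f f' : ℝ → E) (a b : ℝ) : Prop :=
  ContinuousOn f (Icc a b) ∧ ∀ t ∈ Ico a b, HasDerivWithinAt f (f' t) (Ici t) t

theorem Piecewise.hasRightDerivOnIcc {Q : Set ℝ → Prop} (h : Piecewise Q) {f f' : ℝ → E} {a b : ℝ}
    (ha : 0 ≤ a) (hb : b ≤ 1)
    (hf : ∀ c d, c < d → Q (Icc c d) → ∀ t ∈ Icc c d, t ∈ Icc a b →
      HasDerivWithinAt f (f' t) (Icc c d) t) :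
    HasRightDerivOnIcc f f' a b :=
  ⟨h.continuousOn ha hb fun c d hcd hQ t ht htab => (hf c d hcd hQ t ht htab).continuousWithinAt,
    fun t ht => h.hasDerivWithinAt_Ici ⟨ha.trans ht.1, ht.2.trans_le hb⟩ fun c d hcd hQ htcd =>
      hf c d hcd hQ t htcd (Ico_subset_Icc_self ht)⟩

namespace HasRightDerivOnIcc

theorem of_hasDerivAt {f f' : ℝ → E} (hf : ∀ t, HasDerivAt f (f' t) t) (a b : ℝ) :
    HasRightDerivOnIcc f f' a b :=
  ⟨fun t _ => (hf t).continuousAt.continuousWithinAt, fun t _ => (hf t).hasDerivWithinAt⟩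

theorem add {f f' g g' : ℝ → E} {a b : ℝ} (hf : HasRightDerivOnIcc f f' a b)
    (hg : HasRightDerivOnIcc g g' a b) : HasRightDerivOnIcc (f + g) (f' + g') a b :=
  ⟨hf.1.add hg.1, fun t ht => (hf.2 t ht).add (hg.2 t ht)⟩

variable {ι : Type*} {l : Filter ι} {f f' : ι → ℝ → E} {φ : ι → ℝ}

theorem isBigOWith_sub {C : ℝ} (hf : ∀ᶠ i in l, HasRightDerivOnIcc (f i) (f' i) 0 1)
    (hf' : IsBigOWith C (l ×ˢ 𝓟 (Icc 0 1)) (fun p => f' p.1 p.2) fun p => φ p.1) :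
    IsBigOWith C (l ×ˢ 𝓟 (Icc 0 1)) (fun p => f p.1 p.2 - f p.1 0) fun p => φ p.1 := by
  rw [isBigOWith_iff, eventually_prod_principal_iff] at *
  filter_upwards [hf, hf'] with i hfi hfi' t ht
  have bound_nonneg : 0 ≤ C * ‖φ i‖ :=
    (norm_nonneg _).trans (hfi' 0 (left_mem_Icc.2 zero_le_one))
  refine (norm_image_sub_le_of_norm_deriv_right_le_segment hfi.1 hfi.2
    (fun t ht => hfi' t (Ico_subset_Icc_self ht)) t ht).trans ?_
  exact mul_le_of_le_one_right bound_nonneg (by simpa only [sub_zero] using ht.2)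

theorem isBigO_sub (hf : ∀ᶠ i in l, HasRightDerivOnIcc (f i) (f' i) 0 1)
    (hf' : (fun p : ι × ℝ => f' p.1 p.2) =O[l ×ˢ 𝓟 (Icc 0 1)] fun p => φ p.1) :
    (fun p : ι × ℝ => f p.1 p.2 - f p.1 0) =O[l ×ˢ 𝓟 (Icc 0 1)] fun p => φ p.1 := by
  obtain ⟨C, hC⟩ := hf'.isBigOWith
  exact (isBigOWith_sub hf hC).isBigO

theorem isLittleO_sub (hf : ∀ᶠ i in l, HasRightDerivOnIcc (f i) (f' i) 0 1)
    (hf' : (fun p : ι × ℝ => f' p.1 p.2) =o[l ×ˢ 𝓟 (Icc 0 1)] fun p => φ p.1) :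
    (fun p : ι × ℝ => f p.1 p.2 - f p.1 0) =o[l ×ˢ 𝓟 (Icc 0 1)] fun p => φ p.1 :=
  IsLittleO.of_isBigOWith fun _ hC => isBigOWith_sub hf (hf'.forall_isBigOWith hC)

theorem isBigO_initial (hf : ∀ᶠ i in l, HasRightDerivOnIcc (f i) (f' i) 0 1)
    (hf' : (fun p : ι × ℝ => f' p.1 p.2) =O[l ×ˢ 𝓟 (Icc 0 1)] fun p => f p.1 p.2) :
    (fun p : ι × ℝ => f p.1 p.2) =O[l ×ˢ 𝓟 (Icc 0 1)] fun p => f p.1 0 := by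
  obtain ⟨K, hK, hfK⟩ := hf'.exists_nonneg
  rw [isBigOWith_iff, eventually_prod_principal_iff] at hfK
  refine IsBigO.of_bound (Real.exp K) (eventually_prod_principal_iff.2 ?_)
  filter_upwards [hf, hfK] with i hfi hfKi t ht
  have gronwall := norm_le_gronwallBound_of_norm_deriv_right_le hfi.1 hfi.2 le_rfl
    (fun t ht => (hfKi t (Ico_subset_Icc_self ht)).trans_eq (add_zero _).symm) t ht
  rw [gronwallBound_ε0, mul_comm] at gronwall
  refine gronwall.trans (mul_le_mul_of_nonneg_right (Real.exp_le_exp.2 ?_) (norm_nonneg _))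
  exact mul_le_of_le_one_right hK (by simpa only [sub_zero] using ht.2)

end HasRightDerivOnIcc

theorem isBigO_clm_apply {α : Type*} {l : Filter α} {L : α → E →L[ℝ] F} {x : α → E} {φ ψ : α → ℝ}
    (hL : L =O[l] φ) (hx : x =O[l] ψ) : (fun i => L i (x i)) =O[l] fun i => φ i * ψ i :=
  (isBigO_of_le l fun i => ((L i).le_opNorm (x i)).trans (Real.norm_of_nonneg (by positivity)).ge)
    |>.trans (hL.norm_left.mul hx.norm_left)

theorem isLittleO_clm_apply_of_isBigO {α : Type*} {l : Filter α} {L : α → E →L[ℝ] F} {x : α → E}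
    {φ ψ : α → ℝ} (hL : L =o[l] φ) (hx : x =O[l] ψ) :
    (fun i => L i (x i)) =o[l] fun i => φ i * ψ i :=
  (isBigO_of_le l fun i => ((L i).le_opNorm (x i)).trans (Real.norm_of_nonneg (by positivity)).ge)
    |>.trans_isLittleO (hL.norm_left.mul_isBigO hx.norm_left)

theorem exists_continuousLinearEquiv_pi_apply_eq (E F : Type*) [NormedAddCommGroup E]
    [NormedSpace ℝ E] [FiniteDimensional ℝ E] [NormedAddCommGroup F] [NormedSpace ℝ F] :
    ∃ (n : ℕ) (b : Fin n → E) (e : (E →L[ℝ] F) ≃L[ℝ] (Fin n → F)), ∀ L i, e L i = L (b i) := by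
  let basisEquiv : E ≃L[ℝ] (Fin (Module.finrank ℝ E) → ℝ) :=
    ContinuousLinearEquiv.ofFinrankEq (Module.finrank_fin_fun ℝ).symm
  exact ⟨_, fun i => basisEquiv.symm (Pi.single i 1), (basisEquiv.arrowCongr (1 : F ≃L[ℝ] F)).trans
    (ContinuousLinearEquiv.piRing _), fun L i => rfl⟩

theorem isLittleO_clm_of_forall_apply [FiniteDimensional ℝ E] {α : Type*} {l : Filter α}
    {L : α → E →L[ℝ] F} {φ : α → ℝ} (h : ∀ v, (fun i => L i v) =o[l] φ) : L =o[l] φ := by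
  obtain ⟨n, b, e, he⟩ := exists_continuousLinearEquiv_pi_apply_eq E F
  refine (e.isBigO_comp_rev L l).trans_isLittleO (isLittleO_pi.2 fun j => ?_)
  simpa only [he] using h (b j)

theorem isLittleO_taylor_of_hasFDerivAt {α : Type*} {l : Filter α} {f : E → F} {f' : E →L[ℝ] F}
    {u : E} (hf : HasFDerivAt f f' u) {x : α → E} {ρ : α → ℝ} (hx : x =O[l] ρ)
    (hρ : Tendsto ρ l (𝓝 0)) : (fun i => f (u + x i) - f u - f' (x i)) =o[l] ρ :=
  ((hasFDerivAt_iff_isLittleO_nhds_zero.1 hf).comp_tendsto (hx.trans_tendsto hρ)).trans_isBigO hx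

end RightDerivatives

section HolonomyExpansion

set_option maxSynthPendingDepth 3

open Asymptotics

variable {E : Type*} [NormedAddCommGroup E] [NormedSpace ℝ E]

theorem isBigO_one_of_continuous {ι F : Type*} [NormedAddCommGroup F] {c : ℝ → F}
    (hc : Continuous c) (l : Filter ι) :
    (fun p : ι × ℝ => c p.2) =O[l ×ˢ 𝓟 (Icc 0 1)] fun _ => (1 : ℝ) := by
  obtain ⟨C, hC⟩ := isCompact_Icc.exists_bound_of_continuousOn (s := Icc (0 : ℝ) 1) hc.continuousOn
  refine IsBigO.of_bound C (eventually_prod_principal_iff.2 (.of_forall fun _ t ht => ?_))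
  simpa only [norm_one, mul_one] using hC t ht

/-- The integrand of the second order part of the holonomy of a connection along a curve with
position `a` and velocity `b`, applied to the vector `v`. Here `Γ` is the Christoffel form of the
connection at the base point, `Γ v b` being the derivative in the direction `b` of the field with
constant representative `v`, and `DΓ` is the derivative of the Christoffel form. -/
noncomputable def holonomyIntegrand (Γ : E →L[ℝ] E →L[ℝ] E) (DΓ : E →L[ℝ] E →L[ℝ] E →L[ℝ] E)
    (v a b : E) : E :=
  DΓ a v b - Γ (Γ v a) b

/-- The maps `W i` represent vector fields with initial value `v` along the curves `u + r i • c`,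
which are parallel for the connection with Christoffel form `Γ`. -/
def IsParallelFamily {ι : Type*} (l : Filter ι) (Γ : E → E →L[ℝ] E →L[ℝ] E) (u : E) (r : ι → ℝ)
    (c c' : ℝ → E) (v : E) (W : ι → ℝ → E) : Prop :=
  ∀ᶠ i in l, W i 0 = v ∧
    HasRightDerivOnIcc (W i) (fun t => -Γ (u + r i • c t) (W i t) (r i • c' t)) 0 1

namespace IsParallelFamily

variable {ι : Type*} {l : Filter ι} {Γ : E → E →L[ℝ] E →L[ℝ] E} {DΓ : E →L[ℝ] E →L[ℝ] E →L[ℝ] E}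
  {u : E} {r : ι → ℝ} {c c' : ℝ → E} {v : E} {W : ι → ℝ → E}

theorem hasRightDerivOnIcc (hW : IsParallelFamily l Γ u r c c' v W) :
    ∀ᶠ i in l, HasRightDerivOnIcc (W i)
      (fun t => -Γ (u + r i • c t) (W i t) (r i • c' t)) 0 1 :=
  hW.mono fun _ hi => hi.2

theorem initial_eq (hW : IsParallelFamily l Γ u r c c' v W) :
    ∀ᶠ p in l ×ˢ 𝓟 (Icc (0 : ℝ) 1), W p.1 0 = v :=
  (hW.mono fun _ hi => hi.1).prod_inl _

theorem isBigO_smul_curve (hc : Continuous c) :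
    (fun p : ι × ℝ => r p.1 • c p.2) =O[l ×ˢ 𝓟 (Icc 0 1)] fun p => r p.1 := by
  simpa only [smul_eq_mul, mul_one] using
    (isBigO_refl (fun p : ι × ℝ => r p.1) _).smul (isBigO_one_of_continuous hc l)

theorem isBigO_christoffel_sub (hΓ : HasFDerivAt Γ DΓ u) (hr : Tendsto r l (𝓝 0))
    (hc : Continuous c) :
    (fun p : ι × ℝ => Γ (u + r p.1 • c p.2) - Γ u) =O[l ×ˢ 𝓟 (Icc 0 1)] fun p => r p.1 := by
  have taylor := isLittleO_taylor_of_hasFDerivAt hΓ (isBigO_smul_curve (r := r) (l := l) hc)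
    (hr.comp tendsto_fst)
  have linear_part := (DΓ.isBigO_comp _ (l ×ˢ 𝓟 (Icc 0 1))).trans (isBigO_smul_curve (r := r) hc)
  simpa only [sub_add_cancel] using taylor.isBigO.add linear_part

theorem isBigO_christoffel (hΓ : HasFDerivAt Γ DΓ u) (hr : Tendsto r l (𝓝 0))
    (hc : Continuous c) :
    (fun p : ι × ℝ => Γ (u + r p.1 • c p.2)) =O[l ×ˢ 𝓟 (Icc 0 1)] fun _ => (1 : ℝ) := by
  have r_isBigO_one : (fun p : ι × ℝ => r p.1) =O[l ×ˢ 𝓟 (Icc 0 1)] fun _ => (1 : ℝ) :=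
    (hr.comp tendsto_fst).isBigO_one ℝ
  simpa only [sub_add_cancel] using ((isBigO_christoffel_sub hΓ hr hc).trans r_isBigO_one).add
    (isBigO_const_const (Γ u) one_ne_zero _)

theorem isBigO_deriv (hΓ : HasFDerivAt Γ DΓ u) (hr : Tendsto r l (𝓝 0)) (hc : Continuous c)
    (hc' : Continuous c') {ψ : ι × ℝ → ℝ}
    (hψ : (fun p : ι × ℝ => W p.1 p.2) =O[l ×ˢ 𝓟 (Icc 0 1)] ψ) :
    (fun p : ι × ℝ => -Γ (u + r p.1 • c p.2) (W p.1 p.2) (r p.1 • c' p.2))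
      =O[l ×ˢ 𝓟 (Icc 0 1)] fun p => ψ p * r p.1 := by
  simpa only [one_mul] using (isBigO_clm_apply
    (isBigO_clm_apply (isBigO_christoffel hΓ hr hc) hψ) (isBigO_smul_curve (r := r) hc')).neg_left

theorem isBigO_one (hW : IsParallelFamily l Γ u r c c' v W) (hΓ : HasFDerivAt Γ DΓ u)
    (hr : Tendsto r l (𝓝 0)) (hc : Continuous c) (hc' : Continuous c') :
    (fun p : ι × ℝ => W p.1 p.2) =O[l ×ˢ 𝓟 (Icc 0 1)] fun _ => (1 : ℝ) := by
  have deriv_isBigO : (fun p : ι × ℝ => -Γ (u + r p.1 • c p.2) (W p.1 p.2) (r p.1 • c' p.2))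
      =O[l ×ˢ 𝓟 (Icc 0 1)] fun p => W p.1 p.2 := by
    have r_isBigO_one : (fun p : ι × ℝ => r p.1) =O[l ×ˢ 𝓟 (Icc 0 1)] fun _ => (1 : ℝ) :=
      (hr.comp tendsto_fst).isBigO_one ℝ
    refine (isBigO_deriv hΓ hr hc hc' (isBigO_refl _ _).norm_right).trans ?_
    have product_isBigO := (isBigO_refl (fun p : ι × ℝ => ‖W p.1 p.2‖) _).mul r_isBigO_one
    simp only [mul_one] at product_isBigO
    exact product_isBigO.of_norm_right
  refine (HasRightDerivOnIcc.isBigO_initial hW.hasRightDerivOnIcc deriv_isBigO).trans ?_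
  exact (isBigO_const_const v one_ne_zero _).congr' (hW.initial_eq.mono fun p hp => hp.symm) .rfl

theorem sub_isBigO (hW : IsParallelFamily l Γ u r c c' v W) (hΓ : HasFDerivAt Γ DΓ u)
    (hr : Tendsto r l (𝓝 0)) (hc : Continuous c) (hc' : Continuous c') :
    (fun p : ι × ℝ => W p.1 p.2 - v) =O[l ×ˢ 𝓟 (Icc 0 1)] fun p => r p.1 := by
  have deriv_isBigO := isBigO_deriv hΓ hr hc hc' (hW.isBigO_one hΓ hr hc hc')
  simp only [one_mul] at deriv_isBigO
  exact (HasRightDerivOnIcc.isBigO_sub (φ := r) hW.hasRightDerivOnIcc deriv_isBigO).congr'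
    (hW.initial_eq.mono fun p hp => by simp only [hp]) .rfl

theorem hasRightDerivOnIcc_add (hW : IsParallelFamily l Γ u r c c' v W)
    (hc : ∀ t, HasDerivAt c (c' t) t) :
    ∀ᶠ i in l, HasRightDerivOnIcc (W i + fun t => r i • Γ u v (c t))
      ((fun t => -Γ (u + r i • c t) (W i t) (r i • c' t)) + fun t => r i • Γ u v (c' t)) 0 1 :=
  hW.hasRightDerivOnIcc.mono fun i hi => hi.add <| .of_hasDerivAt (fun t =>
    ((Γ u v).hasFDerivAt.comp_hasDerivAt t (hc t)).const_smul (r i)) 0 1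

theorem sub_add_isBigO (hW : IsParallelFamily l Γ u r c c' v W) (hΓ : HasFDerivAt Γ DΓ u)
    (hr : Tendsto r l (𝓝 0)) (hc : ∀ t, HasDerivAt c (c' t) t) (hc' : Continuous c')
    (hc_zero : c 0 = 0) :
    (fun p : ι × ℝ => W p.1 p.2 - v + r p.1 • Γ u v (c p.2))
      =O[l ×ˢ 𝓟 (Icc 0 1)] fun p => r p.1 ^ 2 := by
  have c_cont : Continuous c := continuous_iff_continuousAt.2 fun t => (hc t).continuousAt
  have deriv_eq : ∀ (i : ι) (t : ℝ),
      -Γ (u + r i • c t) (W i t) (r i • c' t) + r i • Γ u v (c' t)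
        = -((Γ (u + r i • c t) - Γ u) (W i t) (r i • c' t)
          + Γ u (W i t - v) (r i • c' t)) := fun i t => by
    simp only [sub_apply, map_sub, map_smul]
    module
  have first_term := isBigO_clm_apply (isBigO_clm_apply (isBigO_christoffel_sub hΓ hr c_cont)
    (hW.isBigO_one hΓ hr c_cont hc')) (isBigO_smul_curve (r := r) hc')
  have second_term := isBigO_clm_apply (((Γ u).isBigO_comp _ _).trans
    (hW.sub_isBigO hΓ hr c_cont hc')) (isBigO_smul_curve (r := r) hc')
  have deriv_isBigO := (first_term.congr_right fun p => by rw [mul_one]).add second_term |>.neg_left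
  simp only [← deriv_eq, ← sq] at deriv_isBigO
  refine (HasRightDerivOnIcc.isBigO_sub (φ := fun i => r i ^ 2)
    (hW.hasRightDerivOnIcc_add hc) deriv_isBigO).congr' (hW.initial_eq.mono fun p hp => ?_) .rfl
  simp only [Pi.add_apply, hp, hc_zero, map_zero, smul_zero, add_zero]
  abel

theorem sub_add_add_isLittleO (hW : IsParallelFamily l Γ u r c c' v W) (hΓ : HasFDerivAt Γ DΓ u)
    (hr : Tendsto r l (𝓝 0)) (hc : ∀ t, HasDerivAt c (c' t) t) (hc' : Continuous c')
    (hc_zero : c 0 = 0) {J : ℝ → E} (hJ_zero : J 0 = 0)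
    (hJ : ∀ t, HasDerivAt J (holonomyIntegrand (Γ u) DΓ v (c t) (c' t)) t) :
    (fun p : ι × ℝ => W p.1 p.2 - v + r p.1 • Γ u v (c p.2) + r p.1 ^ 2 • J p.2)
      =o[l ×ˢ 𝓟 (Icc 0 1)] fun p => r p.1 ^ 2 := by
  have c_cont : Continuous c := continuous_iff_continuousAt.2 fun t => (hc t).continuousAt
  have deriv_eq : ∀ (i : ι) (t : ℝ),
      -Γ (u + r i • c t) (W i t) (r i • c' t) + r i • Γ u v (c' t)
          + r i ^ 2 • holonomyIntegrand (Γ u) DΓ v (c t) (c' t)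
        = -((Γ (u + r i • c t) - Γ u - DΓ (r i • c t)) (W i t) (r i • c' t)
          + (DΓ (r i • c t) (W i t - v) (r i • c' t)
            + Γ u (W i t - v + r i • Γ u v (c t)) (r i • c' t))) := fun i t => by
    simp only [holonomyIntegrand, sub_apply, smul_apply, map_sub, map_add, map_smul, add_apply]
    module
  have cube_isLittleO : (fun p : ι × ℝ => r p.1 ^ 2 * r p.1)
      =o[l ×ˢ 𝓟 (Icc 0 1)] fun p => r p.1 ^ 2 := by
    have r_isLittleO_one : (fun p : ι × ℝ => r p.1) =o[l ×ˢ 𝓟 (Icc 0 1)] fun _ => (1 : ℝ) :=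
      (isLittleO_one_iff ℝ).2 (hr.comp tendsto_fst)
    simpa only [mul_one] using (isBigO_refl (fun p : ι × ℝ => r p.1 ^ 2) _).mul_isLittleO
      r_isLittleO_one
  have taylor_term := isLittleO_clm_apply_of_isBigO (isLittleO_clm_apply_of_isBigO
    (isLittleO_taylor_of_hasFDerivAt hΓ (isBigO_smul_curve (r := r) c_cont)
      (hr.comp tendsto_fst)) (hW.isBigO_one hΓ hr c_cont hc')) (isBigO_smul_curve (r := r) hc')
  have first_term := isBigO_clm_apply (isBigO_clm_apply ((DΓ.isBigO_comp _ _).trans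
    (isBigO_smul_curve (r := r) c_cont)) (hW.sub_isBigO hΓ hr c_cont hc'))
    (isBigO_smul_curve (r := r) hc')
  have second_term := isBigO_clm_apply (((Γ u).isBigO_comp _ _).trans
    (hW.sub_add_isBigO hΓ hr hc hc' hc_zero)) (isBigO_smul_curve (r := r) hc')
  have deriv_isLittleO := ((taylor_term.congr_right fun p => by
    rw [mul_one, ← sq]).add
      (((first_term.congr_right fun p => by rw [← sq]).add second_term).trans_isLittleO
        cube_isLittleO)).neg_left
  simp only [← deriv_eq] at deriv_isLittleO
  have right_deriv := (hW.hasRightDerivOnIcc_add hc).mono fun i hi =>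
    hi.add (.of_hasDerivAt (fun t => (hJ t).const_smul (r i ^ 2)) 0 1)
  refine (HasRightDerivOnIcc.isLittleO_sub (φ := fun i => r i ^ 2) right_deriv
    deriv_isLittleO).congr' (hW.initial_eq.mono fun p hp => ?_) .rfl
  simp only [Pi.add_apply, hp, hc_zero, hJ_zero, map_zero, smul_zero, add_zero, Pi.smul_apply]
  abel

end IsParallelFamily

/-- A closed polynomial curve in the plane spanned by `x` and `y` that encloses the signed area
`1 / 60`. -/
def loop (x y : E) (t : ℝ) : E :=
  (t - t ^ 2) • x + (t ^ 2 - t ^ 3) • y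

/-- The velocity of `loop`. -/
def loopDeriv (x y : E) (t : ℝ) : E :=
  (1 - 2 * t) • x + (2 * t - 3 * t ^ 2) • y

theorem hasDerivAt_cubic_sub_quartic_add_quintic (p q r t : ℝ) :
    HasDerivAt (fun t : ℝ => p * t ^ 3 - q * t ^ 4 + r * t ^ 5)
      (p * (3 * t ^ 2) - q * (4 * t ^ 3) + r * (5 * t ^ 4)) t :=
  ((((hasDerivAt_pow 3 t).const_mul p).sub ((hasDerivAt_pow 4 t).const_mul q)).add
    ((hasDerivAt_pow 5 t).const_mul r)).congr_deriv (by simp)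

theorem hasDerivAt_loop_coeff_left (t : ℝ) :
    HasDerivAt (fun t : ℝ => t - t ^ 2) (1 - 2 * t) t :=
  ((hasDerivAt_id t).sub (hasDerivAt_pow 2 t)).congr_deriv (by simp)

theorem hasDerivAt_loop_coeff_right (t : ℝ) :
    HasDerivAt (fun t : ℝ => t ^ 2 - t ^ 3) (2 * t - 3 * t ^ 2) t :=
  ((hasDerivAt_pow 2 t).sub (hasDerivAt_pow 3 t)).congr_deriv (by simp)

theorem hasDerivAt_sq_div_two {f : ℝ → ℝ} {f' t : ℝ} (hf : HasDerivAt f f' t) :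
    HasDerivAt (fun t => f t ^ 2 / 2) (f t * f') t :=
  ((hf.pow 2).div_const 2).congr_deriv (by ring)

theorem hasDerivAt_loop (x y : E) (t : ℝ) : HasDerivAt (loop x y) (loopDeriv x y t) t :=
  ((hasDerivAt_loop_coeff_left t).smul_const x).add ((hasDerivAt_loop_coeff_right t).smul_const y)

theorem contDiff_loop (x y : E) {n : WithTop ℕ∞} : ContDiff ℝ n (loop x y) := by
  unfold loop
  fun_prop

theorem continuous_loopDeriv (x y : E) : Continuous (loopDeriv x y) := by
  unfold loopDeriv
  fun_prop

@[simp]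
theorem loop_zero (x y : E) : loop x y 0 = 0 := by
  simp [loop]

@[simp]
theorem loop_one (x y : E) : loop x y 1 = 0 := by
  simp [loop]

/-- The curvature at a point of a connection with Christoffel form `Γ` (the second argument of
`Γ v w` is the direction) and derivative `DΓ` of the Christoffel form. -/
noncomputable def curvatureForm (Γ : E →L[ℝ] E →L[ℝ] E) (DΓ : E →L[ℝ] E →L[ℝ] E →L[ℝ] E)
    (x y : E) : E →L[ℝ] E :=
  (DΓ x).flip y - (DΓ y).flip x - (Γ.flip y) ∘L (Γ.flip x) + (Γ.flip x) ∘L (Γ.flip y)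

theorem curvatureForm_apply (Γ : E →L[ℝ] E →L[ℝ] E) (DΓ : E →L[ℝ] E →L[ℝ] E →L[ℝ] E)
    (x y v : E) :
    curvatureForm Γ DΓ x y v = DΓ x v y - DΓ y v x - Γ (Γ v x) y + Γ (Γ v y) x := by
  simp [curvatureForm]

theorem exists_hasDerivAt_holonomyIntegrand_loop (Γ : E →L[ℝ] E →L[ℝ] E)
    (DΓ : E →L[ℝ] E →L[ℝ] E →L[ℝ] E) (x y v : E) :
    ∃ J : ℝ → E, J 0 = 0 ∧ J 1 = (1 / 60 : ℝ) • curvatureForm Γ DΓ x y v ∧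
      ∀ t, HasDerivAt J (holonomyIntegrand Γ DΓ v (loop x y t) (loopDeriv x y t)) t := by
  refine ⟨fun t => ((t - t ^ 2) ^ 2 / 2) • holonomyIntegrand Γ DΓ v x x
    + ((t ^ 2 - t ^ 3) ^ 2 / 2) • holonomyIntegrand Γ DΓ v y y
    + (2 / 3 * t ^ 3 - 5 / 4 * t ^ 4 + 3 / 5 * t ^ 5) • holonomyIntegrand Γ DΓ v x y
    + (1 / 3 * t ^ 3 - 3 / 4 * t ^ 4 + 2 / 5 * t ^ 5) • holonomyIntegrand Γ DΓ v y x,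
    by simp, ?_, fun t => ?_⟩
  · simp only [curvatureForm_apply, holonomyIntegrand]
    module
  · refine (((((hasDerivAt_sq_div_two (hasDerivAt_loop_coeff_left t)).smul_const _).add
      ((hasDerivAt_sq_div_two (hasDerivAt_loop_coeff_right t)).smul_const _)).add
      ((hasDerivAt_cubic_sub_quartic_add_quintic _ _ _ t).smul_const _)).add
      ((hasDerivAt_cubic_sub_quartic_add_quintic _ _ _ t).smul_const _)).congr_deriv ?_
    simp only [holonomyIntegrand, loop, loopDeriv, map_add, map_smul, add_apply, smul_apply]
    module

theorem IsParallelFamily.sub_add_curvatureForm_isLittleO {ι : Type*} {l : Filter ι}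
    {Γ : E → E →L[ℝ] E →L[ℝ] E} {DΓ : E →L[ℝ] E →L[ℝ] E →L[ℝ] E} {u : E} {r : ι → ℝ} {x y v : E}
    {W : ι → ℝ → E} (hW : IsParallelFamily l Γ u r (loop x y) (loopDeriv x y) v W)
    (hΓ : HasFDerivAt Γ DΓ u) (hr : Tendsto r l (𝓝 0)) :
    (fun i => W i 1 - v + r i ^ 2 • (1 / 60 : ℝ) • curvatureForm (Γ u) DΓ x y v)
      =o[l] fun i => r i ^ 2 := by
  obtain ⟨J, hJ_zero, hJ_one, hJ⟩ := exists_hasDerivAt_holonomyIntegrand_loop (Γ u) DΓ x y v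
  have expansion := hW.sub_add_add_isLittleO hΓ hr (hasDerivAt_loop x y)
    (continuous_loopDeriv x y) (loop_zero x y) hJ_zero hJ
  have endpoint : Tendsto (fun i => (i, (1 : ℝ))) l (l ×ˢ 𝓟 (Icc 0 1)) :=
    tendsto_id.prodMk (tendsto_principal.2 (.of_forall fun _ => right_mem_Icc.2 zero_le_one))
  simpa only [Function.comp_def, hJ_one, loop_one, map_zero, smul_zero, add_zero] using
    expansion.comp_tendsto endpoint

end HolonomyExpansion

section Coframes

variable {d : ℕ} {M : Type u} [TopologicalSpace M] [ChartedSpace (Euc d) M]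
  [IsManifold (𝓡 d) ∞ M]

@[simp]
theorem trivializationAt_self_apply (p : M) (v : TangentSpace (𝓡 d) p) :
    (trivializationAt (Euc d) (TangentSpace (𝓡 d)) p ⟨p, v⟩).2 = v :=
  (tangentBundleCore (𝓡 d) M).coordChange_self (achart (Euc d) p) p (mem_chart_source _ p) v

theorem symm_trivializationAt_self (p : M) (v : Euc d) :
    (trivializationAt (Euc d) (TangentSpace (𝓡 d)) p).symm p v = v :=
  (congrArg _ (trivializationAt_self_apply p v).symm).trans
    ((trivializationAt (Euc d) (TangentSpace (𝓡 d)) p).symm_apply_apply_mk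
      (FiberBundle.mem_baseSet_trivializationAt' p) (v : TangentSpace (𝓡 d) p))

theorem extend_eq_symm_trivializationAt {p : M} (v : TangentSpace (𝓡 d) p) :
    FiberBundle.extend (Euc d) v =
      fun x => (trivializationAt (Euc d) (TangentSpace (𝓡 d)) p).symm x v := by
  funext x
  rw [FiberBundle.extend, trivializationAt_self_apply]

/-- `Φ` is a coframe on `U`: an `ℝ^d`-valued one-form that is invertible at the points of `U`, and
differentiable there, that is, in the trivialization of `TM` given by the chart at the point. -/
structure IsCoframeOn (Φ : (p : M) → TangentSpace (𝓡 d) p →L[ℝ] Euc d) (U : Set M) : Prop where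
  isInvertible : ∀ x ∈ U, (Φ x).IsInvertible
  mdifferentiableAt : ∀ q ∈ U, MDifferentiableAt (𝓡 d) 𝓘(ℝ, Euc d →L[ℝ] Euc d) (fun x =>
    (Φ x ∘L (trivializationAt (Euc d) (TangentSpace (𝓡 d)) q).symmL ℝ x : Euc d →L[ℝ] Euc d)) q

variable {Φ : (p : M) → TangentSpace (𝓡 d) p →L[ℝ] Euc d} {U : Set M} {x : M}

theorem eventually_comp_symmL_apply (Φ : (p : M) → TangentSpace (𝓡 d) p →L[ℝ] Euc d) (x : M) :
    ∀ᶠ q in 𝓝 x, ∀ v : TangentSpace (𝓡 d) q,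
      (Φ q ∘L (trivializationAt (Euc d) (TangentSpace (𝓡 d)) x).symmL ℝ q)
        (trivializationAt (Euc d) (TangentSpace (𝓡 d)) x ⟨q, v⟩).2 = Φ q v := by
  let e := trivializationAt (Euc d) (TangentSpace (𝓡 d)) x
  filter_upwards [e.open_baseSet.mem_nhds (FiberBundle.mem_baseSet_trivializationAt' x)]
    with q hq v
  rw [ContinuousLinearMap.comp_apply, e.symmL_apply hq, e.symm_apply_apply_mk hq]

theorem IsCoframeOn.mdifferentiableAt_apply (hΦ : IsCoframeOn Φ U) (hx : x ∈ U)
    {σ : (q : M) → TangentSpace (𝓡 d) q}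
    (hσ : MDifferentiableAt (𝓡 d) (𝓡 d).tangent
      (fun q => (⟨q, σ q⟩ : TangentBundle (𝓡 d) M)) x) :
    MDifferentiableAt (𝓡 d) 𝓘(ℝ, Euc d) (fun q => Φ q (σ q)) x :=
  ((hΦ.mdifferentiableAt x hx).clm_apply ((mdifferentiableAt_section (𝓡 d) σ).1 hσ))
    |>.congr_of_eventuallyEq ((eventually_comp_symmL_apply Φ x).mono fun q hq => (hq (σ q)).symm)

/-- The connection for which the coframe `Φ` is parallel. -/
noncomputable def flatConn (Φ : (p : M) → TangentSpace (𝓡 d) p →L[ℝ] Euc d) : Conn d M :=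
  fun σ x => (Φ x).inverse ∘L mvfderiv (𝓡 d) (fun q => Φ q (σ q)) x

theorem IsCoframeOn.isCovariantDerivativeOn_flatConn (hΦ : IsCoframeOn Φ U) :
    IsCovariantDerivativeOn (Euc d) (flatConn Φ) U where
  add {σ τ x} hσ hτ hx := by
    have apply_add : (fun q => Φ q ((σ + τ) q)) = (fun q => Φ q (σ q)) + fun q => Φ q (τ q) :=
      funext fun q => map_add (Φ q) _ _
    simp only [flatConn, apply_add, mvfderiv_add (hΦ.mdifferentiableAt_apply hx hσ)
      (hΦ.mdifferentiableAt_apply hx hτ), ContinuousLinearMap.comp_add]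
  leibniz {σ g x} hσ hg hx := by
    have apply_smul : (fun q => Φ q ((g • σ) q)) = g • fun q => Φ q (σ q) :=
      funext fun q => map_smul (Φ q) _ _
    rw [flatConn, apply_smul, mvfderiv_smul hg (hΦ.mdifferentiableAt_apply hx hσ)]
    ext v
    simp [flatConn, hΦ.isInvertible x hx]

variable {D : Conn d M}

/-- The connection form of the connection `D` with respect to the coframe `Φ`, with values in
`ℝ^d`: it vanishes if and only if `Φ` is parallel. The second argument is the direction. -/
noncomputable def connectionForm (hD : IsCovariantDerivativeOn (Euc d) D U)
    (hΦ : IsCoframeOn Φ U) (x : M) :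
    TangentSpace (𝓡 d) x →L[ℝ] TangentSpace (𝓡 d) x →L[ℝ] Euc d :=
  (Φ x).postcomp (TangentSpace (𝓡 d) x) ∘L
    IsCovariantDerivativeOn.difference hD hΦ.isCovariantDerivativeOn_flatConn x

theorem connectionForm_apply (hD : IsCovariantDerivativeOn (Euc d) D U) (hΦ : IsCoframeOn Φ U)
    (hx : x ∈ U) {σ : (q : M) → TangentSpace (𝓡 d) q}
    (hσ : MDifferentiableAt (𝓡 d) (𝓡 d).tangent (fun q => (⟨q, σ q⟩ : TangentBundle (𝓡 d) M)) x)
    (w : TangentSpace (𝓡 d) x) :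
    connectionForm hD hΦ x (σ x) w = Φ x (D σ x w) - mvfderiv (𝓡 d) (fun q => Φ q (σ q)) x w := by
  have difference_apply :=
    IsCovariantDerivativeOn.difference_apply hD hΦ.isCovariantDerivativeOn_flatConn hx hσ
  rw [connectionForm, ContinuousLinearMap.comp_apply, difference_apply]
  simp [flatConn, hΦ.isInvertible x hx]

omit [IsManifold (𝓡 d) ∞ M] in
theorem mvfderiv_clm_apply_const {A : M → Euc d →L[ℝ] Euc d} (v : Euc d)
    {A' : TangentSpace (𝓡 d) x →L[ℝ] (Euc d →L[ℝ] Euc d)}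
    (hA : HasMFDerivAt (𝓡 d) 𝓘(ℝ, Euc d →L[ℝ] Euc d) A x A') (w : TangentSpace (𝓡 d) x) :
    mvfderiv (𝓡 d) (fun q => A q v) x w = A' w v := by
  have hasMFDerivAt_apply : HasMFDerivAt (𝓡 d) 𝓘(ℝ, Euc d) (fun q => A q v) x
      ((ContinuousLinearMap.apply ℝ (Euc d) v) ∘L A') :=
    HasMFDerivAt.comp x (ContinuousLinearMap.apply ℝ (Euc d) v).hasMFDerivAt hA
  simp only [mvfderiv, hasMFDerivAt_apply.mfderiv]
  rfl

theorem IsCoframeOn.hasDerivWithinAt_apply (hΦ : IsCoframeOn Φ U)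
    {V : ℝ → TangentBundle (𝓡 d) M} {J : Set ℝ} {t : ℝ} {v' : Euc d} (ht : (V t).proj ∈ U)
    (hγ : MDifferentiableWithinAt 𝓘(ℝ, ℝ) (𝓡 d) (fun τ => (V τ).proj) J t)
    (hV : HasDerivWithinAt (fun τ =>
      (trivializationAt (Euc d) (TangentSpace (𝓡 d)) (V t).proj (V τ)).2) v' J t) :
    HasDerivWithinAt (fun τ => Φ (V τ).proj (V τ).snd)
      (mvfderiv (𝓡 d) (fun x => Φ x (FiberBundle.extend (Euc d) (V t).snd x)) (V t).proj
        (mfderivWithin 𝓘(ℝ, ℝ) (𝓡 d) (fun τ => (V τ).proj) J t (1 : ℝ)) + Φ (V t).proj v') J t := by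
  let e := trivializationAt (Euc d) (TangentSpace (𝓡 d)) (V t).proj
  have mem_baseSet : e.baseSet ∈ 𝓝 (V t).proj :=
    e.open_baseSet.mem_nhds (FiberBundle.mem_baseSet_trivializationAt' _)
  let A : M → Euc d →L[ℝ] Euc d := fun x => Φ x ∘L e.symmL ℝ x
  have A_self (v : Euc d) : A (V t).proj v = Φ (V t).proj v := by
    change Φ (V t).proj (e.symmL ℝ (V t).proj v) = _
    rw [e.symmL_apply (mem_of_mem_nhds mem_baseSet), symm_trivializationAt_self]
  obtain ⟨A', hA⟩ : ∃ A' : TangentSpace (𝓡 d) (V t).proj →L[ℝ] (Euc d →L[ℝ] Euc d),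
      HasMFDerivAt (𝓡 d) 𝓘(ℝ, Euc d →L[ℝ] Euc d) A (V t).proj A' :=
    ⟨_, (hΦ.mdifferentiableAt _ ht).hasMFDerivAt⟩
  have hasDerivWithinAt_A : HasDerivWithinAt (fun τ => A (V τ).proj)
      (A' (mfderivWithin 𝓘(ℝ, ℝ) (𝓡 d) (fun τ => (V τ).proj) J t (1 : ℝ))) J t :=
    have hasMFDerivWithinAt_A : HasMFDerivWithinAt 𝓘(ℝ, ℝ) 𝓘(ℝ, Euc d →L[ℝ] Euc d)
        (A ∘ fun τ => (V τ).proj) J t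
        (A' ∘L mfderivWithin 𝓘(ℝ, ℝ) (𝓡 d) (fun τ => (V τ).proj) J t) :=
      HasMFDerivAt.comp_hasMFDerivWithinAt t hA hγ.hasMFDerivWithinAt
    have hasFDerivWithinAt_A : HasFDerivWithinAt (fun τ => A (V τ).proj)
        (A' ∘L mfderivWithin 𝓘(ℝ, ℝ) (𝓡 d) (fun τ => (V τ).proj) J t :
          ℝ →L[ℝ] Euc d →L[ℝ] Euc d) J t := hasMFDerivWithinAt_A.hasFDerivWithinAt
    hasFDerivWithinAt_A.hasDerivWithinAt
  have A_eq : (fun x => Φ x (FiberBundle.extend (Euc d) (V t).snd x)) =ᶠ[𝓝 (V t).proj]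
      fun x => A x (V t).snd := by
    filter_upwards [mem_baseSet] with x hx
    rw [extend_eq_symm_trivializationAt]
    exact congrArg (Φ x) (e.symmL_apply hx _).symm
  refine ((hasDerivWithinAt_A.clm_apply hV).congr_of_eventuallyEq
    ((hγ.continuousWithinAt.eventually (eventually_comp_symmL_apply Φ _)).mono
      fun τ hτ => (hτ _).symm)
    ((eventually_comp_symmL_apply Φ _).self_of_nhds _).symm).congr_deriv ?_
  rw [trivializationAt_self_apply, A_self, mvfderiv, A_eq.mfderiv_eq]
  exact congrArg (· + _) (mvfderiv_clm_apply_const _ hA _).symm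

theorem IsParallelOn.hasDerivWithinAt_coframe {V : ℝ → TangentBundle (𝓡 d) M} {J : Set ℝ} {t : ℝ}
    (hV : IsParallelOn D V J) (ht : t ∈ J) (hD : IsCovariantDerivativeOn (Euc d) D U)
    (hΦ : IsCoframeOn Φ U) (hU : (V t).proj ∈ U) :
    HasDerivWithinAt (fun τ => Φ (V τ).proj (V τ).snd)
      (-connectionForm hD hΦ (V t).proj (V t).snd
        (mfderivWithin 𝓘(ℝ, ℝ) (𝓡 d) (fun τ => (V τ).proj) J t (1 : ℝ))) J t := by
  have connectionForm_extend := connectionForm_apply hD hΦ hU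
    (FiberBundle.mdifferentiableAt_extend (𝓡 d) (Euc d) (V t).snd)
    (mfderivWithin 𝓘(ℝ, ℝ) (𝓡 d) (fun τ => (V τ).proj) J t (1 : ℝ))
  rw [FiberBundle.extend_apply_self] at connectionForm_extend
  refine (hΦ.hasDerivWithinAt_apply hU ((hV.1 t ht).mdifferentiableWithinAt (by simp))
    (hV.2 t ht)).congr_deriv ?_
  rw [connectionForm_extend, extend_eq_symm_trivializationAt, neg_sub, sub_eq_add_neg]
  exact congrArg (_ + ·) (map_neg (Φ (V t).proj) _)

end Coframes

section LeviCivita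

variable {d : ℕ} {M : Type u} [TopologicalSpace M] [ChartedSpace (Euc d) M]

theorem mvfderiv_inner {f g : M → Euc d} {x : M} (hf : MDifferentiableAt (𝓡 d) 𝓘(ℝ, Euc d) f x)
    (hg : MDifferentiableAt (𝓡 d) 𝓘(ℝ, Euc d) g x) (v : TangentSpace (𝓡 d) x) :
    mvfderiv (𝓡 d) (fun q => (inner ℝ (f q) (g q) : ℝ)) x v
      = inner ℝ (mvfderiv (𝓡 d) f x v) (g x) + inner ℝ (f x) (mvfderiv (𝓡 d) g x v) := by
  have hasMFDerivAt_inner : HasMFDerivAt 𝓘(ℝ, Euc d × Euc d) 𝓘(ℝ, ℝ)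
      (fun z : Euc d × Euc d => (inner ℝ z.1 z.2 : ℝ)) (f x, g x) _ :=
    ((isBoundedBilinearMap_inner (𝕜 := ℝ) (E := Euc d)).hasFDerivAt (f x, g x)).hasMFDerivAt
  have hasMFDerivAt_pair : HasMFDerivAt (𝓡 d) 𝓘(ℝ, Euc d × Euc d) (fun q => (f q, g q)) x
      ((mfderiv (𝓡 d) 𝓘(ℝ, Euc d) f x).prod (mfderiv (𝓡 d) 𝓘(ℝ, Euc d) g x)) :=
    ⟨hf.continuousAt.prodMk hg.continuousAt, hf.hasMFDerivAt.2.prodMk hg.hasMFDerivAt.2⟩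
  have mfderiv_eq : mfderiv (𝓡 d) 𝓘(ℝ, ℝ) (fun q => (inner ℝ (f q) (g q) : ℝ)) x = _ :=
    (HasMFDerivAt.comp (f := fun q => (f q, g q)) x hasMFDerivAt_inner hasMFDerivAt_pair).mfderiv
  simp only [mvfderiv, mfderiv_eq]
  rw [add_comm]
  rfl

theorem trilinear_eq_zero_of_symm_of_skew {V : Type*} {S : V → V → V → ℝ}
    (symm : ∀ a b c, S a b c = S b a c) (skew : ∀ a b c, S a b c = -S c b a) (a b c : V) :
    S a b c = 0 := by
  have eq_neg_self : S a b c = -S a b c := by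
    calc S a b c = -S c b a := skew a b c
      _ = -S b c a := by rw [symm]
      _ = S a c b := by rw [skew, neg_neg]
      _ = S c a b := symm a c b
      _ = -S b a c := skew c a b
      _ = -S a b c := by rw [symm]
  linarith

variable [IsManifold (𝓡 d) ∞ M] {𝒲 : Archetype d}

theorem UniformBody.U_subset_carrier (B : UniformBody.{u, w} M 𝒲) (α : B.ι) :
    B.U α ⊆ B.carrier :=
  B.iUnion_U ▸ subset_iUnion B.U α

theorem UniformBody.isCoframeOn_P (B : UniformBody.{u, w} M 𝒲) (α : B.ι) :
    IsCoframeOn (B.P α) (B.U α) where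
  isInvertible := B.P_invertible α
  mdifferentiableAt q hq := by
    have mdifferentiableAt_section :=
      ((B.P_smooth α).contMDiffAt ((B.isOpen_U α).mem_nhds hq)).mdifferentiableAt (by simp)
    refine ((mdifferentiableAt_hom_bundle _).1 mdifferentiableAt_section).2.congr_of_eventuallyEq
      (Eventually.of_forall fun x => ?_)
    ext v
    simp [ContinuousLinearMap.inCoordinates]

theorem UniformBody.exists_transition (B : UniformBody.{u, w} M 𝒲) {α β : B.ι} {p : M}
    (hα : p ∈ B.U α) (hβ : p ∈ B.U β) :
    ∃ g ∈ symmetryGroup 𝒲, ∀ v : TangentSpace (𝓡 d) p,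
      (g : Euc d →L[ℝ] Euc d) (B.P α p v) = B.P β p v := by
  obtain ⟨e, he⟩ := B.P_invertible α p hα
  obtain ⟨f, hf⟩ := B.P_invertible β p hβ
  refine ⟨(ContinuousLinearEquiv.unitsEquiv ℝ (Euc d)).symm (e.symm.trans f), fun C => ?_,
    fun v => ?_⟩
  · let A : TangentSpace (𝓡 d) p →L[ℝ] Euc d := C ∘L (f : TangentSpace (𝓡 d) p →L[ℝ] Euc d)
    have W_eq : 𝒲 (A ∘L (e : TangentSpace (𝓡 d) p →L[ℝ] Euc d).inverse) =
        𝒲 (A ∘L (f : TangentSpace (𝓡 d) p →L[ℝ] Euc d).inverse) := by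
      rw [he, hf, ← B.W_eq α p hα, ← B.W_eq β p hβ]
    rw [ContinuousLinearMap.inverse_equiv, ContinuousLinearMap.inverse_equiv] at W_eq
    have A_comp_symm : A ∘L (f.symm : Euc d →L[ℝ] TangentSpace (𝓡 d) p) = C := by
      ext v i
      simp [A]
    exact W_eq.trans (congrArg 𝒲 A_comp_symm)
  · rw [← he, ← hf]
    exact congrArg f (e.symm_apply_apply v)

variable {D : Conn d M}

theorem IsClosedFormOn.connectionForm_comm {Φ : (p : M) → TangentSpace (𝓡 d) p →L[ℝ] Euc d}
    {U : Set M} {x : M} (closed : IsClosedFormOn Φ U) (hD : IsCovariantDerivativeOn (Euc d) D U)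
    (hΦ : IsCoframeOn Φ U) (hx : x ∈ U)
    (torsion_free : ∀ X Y : (q : M) → TangentSpace (𝓡 d) q,
      MDifferentiableAt (𝓡 d) (𝓡 d).tangent (fun q => (⟨q, X q⟩ : TangentBundle (𝓡 d) M)) x →
      MDifferentiableAt (𝓡 d) (𝓡 d).tangent (fun q => (⟨q, Y q⟩ : TangentBundle (𝓡 d) M)) x →
      D Y x (X x) - D X x (Y x) = VectorField.mlieBracket (𝓡 d) X Y x)
    (a b : TangentSpace (𝓡 d) x) :
    connectionForm hD hΦ x a b = connectionForm hD hΦ x b a := by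
  have extend_diff (v : TangentSpace (𝓡 d) x) :=
    FiberBundle.mdifferentiableAt_extend (𝓡 d) (Euc d) v
  have form_apply (v w : TangentSpace (𝓡 d) x) :=
    connectionForm_apply hD hΦ hx (extend_diff v) w
  have exterior_derivative := closed x hx _ _ (extend_diff a) (extend_diff b)
  rw [← torsion_free _ _ (extend_diff a) (extend_diff b)] at exterior_derivative
  simp only [FiberBundle.extend_apply_self, map_sub] at form_apply exterior_derivative
  rw [form_apply, form_apply, ← sub_eq_zero, ← exterior_derivative]
  abel

theorem UniformBody.IsLeviCivita.inner_connectionForm {B : UniformBody.{u, w} M 𝒲}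
    (hD : B.IsLeviCivita D) (h𝒲 : IsUndistorted 𝒲) {α : B.ι} {x : M} (hx : x ∈ B.U α)
    (a v b : TangentSpace (𝓡 d) x) :
    (inner ℝ (connectionForm (hD.isCovariantDerivativeOn.mono (B.U_subset_carrier α))
        (B.isCoframeOn_P α) x a v) (B.P α x b) : ℝ) =
      -inner ℝ (connectionForm (hD.isCovariantDerivativeOn.mono (B.U_subset_carrier α))
        (B.isCoframeOn_P α) x b v) (B.P α x a) := by
  have extend_diff (c : TangentSpace (𝓡 d) x) :=
    FiberBundle.mdifferentiableAt_extend (𝓡 d) (Euc d) c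
  have form_apply (c : TangentSpace (𝓡 d) x) :=
    connectionForm_apply (hD.isCovariantDerivativeOn.mono (B.U_subset_carrier α))
      (B.isCoframeOn_P α) hx (extend_diff c) v
  have metric_eventuallyEq : (fun q => B.metric q (FiberBundle.extend (Euc d) a q)
      (FiberBundle.extend (Euc d) b q)) =ᶠ[𝓝 x] fun q =>
      inner ℝ (B.P α q (FiberBundle.extend (Euc d) a q))
        (B.P α q (FiberBundle.extend (Euc d) b q)) := by
    filter_upwards [(B.isOpen_U α).mem_nhds hx] with q hq
    exact B.metric_eq h𝒲 hq _ _
  have mvfderiv_metric := mvfderiv_inner ((B.isCoframeOn_P α).mdifferentiableAt_apply hx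
    (extend_diff a)) ((B.isCoframeOn_P α).mdifferentiableAt_apply hx (extend_diff b)) v
  rw [mvfderiv, ← metric_eventuallyEq.mfderiv_eq] at mvfderiv_metric
  have compatible := (hD.metric_compatible x (B.U_subset_carrier α hx) v _ _ (extend_diff a)
    (extend_diff b)).symm.trans mvfderiv_metric
  rw [B.metric_eq h𝒲 hx, B.metric_eq h𝒲 hx] at compatible
  simp only [FiberBundle.extend_apply_self] at form_apply compatible
  rw [form_apply, form_apply, inner_sub_left, inner_sub_left, real_inner_comm (B.P α x a),
    real_inner_comm (B.P α x a)]
  linarith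

theorem DefectBody.connectionForm_eq_zero (B : DefectBody.{u, w} M 𝒲) (h𝒲 : IsUndistorted 𝒲)
    (hD : B.IsLeviCivita D) {α : B.ι} {x : M} (hx : x ∈ B.U α) (a v : TangentSpace (𝓡 d) x) :
    connectionForm (hD.isCovariantDerivativeOn.mono (B.U_subset_carrier α))
      (B.isCoframeOn_P α) x a v = 0 := by
  let form := connectionForm (hD.isCovariantDerivativeOn.mono (B.U_subset_carrier α))
    (B.isCoframeOn_P α) x
  have inner_eq_zero : ∀ c, (inner ℝ (form a v) (B.P α x c) : ℝ) = 0 :=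
    trilinear_eq_zero_of_symm_of_skew (S := fun a b c => inner ℝ (form a b) (B.P α x c))
      (fun a b c => congrArg (inner ℝ · (B.P α x c)) ((B.P_closed α).connectionForm_comm _ _ hx
        (hD.torsion_free x (B.U_subset_carrier α hx)) a b))
      (hD.inner_connectionForm h𝒲 hx) a v
  obtain ⟨e, he⟩ := B.P_invertible α x hx
  refine inner_self_eq_zero (𝕜 := ℝ).1 ?_
  rw [← inner_eq_zero (e.symm (form a v)), ← he]
  exact congrArg (inner ℝ (form a v)) (e.apply_symm_apply _).symm

end LeviCivita

section Disclinations

variable {d : ℕ} {M : Type u} [TopologicalSpace M] [ChartedSpace (Euc d) M]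

theorem IsClosedCurve.continuousOn {γ : ℝ → M} {p : M} (h : IsClosedCurve d γ p) :
    ContinuousOn γ (Icc 0 1) :=
  h.2.2.continuousOn le_rfl le_rfl fun _ _ _ hJ t ht _ => hJ.continuousOn t ht

variable [IsManifold (𝓡 d) ∞ M] {𝒲 : Archetype d} {D : Conn d M}

theorem DefectBody.P_apply_eq_of_isParallelOn (B : DefectBody.{u, w} M 𝒲)
    (h𝒲 : IsUndistorted 𝒲) (hD : B.IsLeviCivita D) {V : ℝ → TangentBundle (𝓡 d) M}
    (hV : Piecewise (IsParallelOn D V)) {α : B.ι} {a b : ℝ} (ha : a ∈ Icc (0 : ℝ) 1)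
    (hb : b ∈ Icc (0 : ℝ) 1) (hU : ∀ t ∈ uIcc a b, (V t).proj ∈ B.U α) :
    B.P α (V b).proj (V b).snd = B.P α (V a).proj (V a).snd := by
  wlog hab : a ≤ b generalizing a b
  · exact (this hb ha (uIcc_comm a b ▸ hU) (le_of_not_ge hab)).symm
  rw [uIcc_of_le hab] at hU
  have deriv_eq_zero : HasRightDerivOnIcc (fun τ => B.P α (V τ).proj (V τ).snd) 0 a b :=
    hV.hasRightDerivOnIcc ha.1 hb.2 fun c e _ hJ t ht ht' =>
      (hJ.hasDerivWithinAt_coframe ht (hD.isCovariantDerivativeOn.mono (B.U_subset_carrier α))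
        (B.isCoframeOn_P α) (hU t ht')).congr_deriv
        (neg_eq_zero.2 (B.connectionForm_eq_zero h𝒲 hD (hU t ht') _ _))
  exact constant_of_has_deriv_right_zero deriv_eq_zero.1 deriv_eq_zero.2 b ⟨hab, le_rfl⟩

/-- Parallel transport along `γ` from time `a` to time `b` is a symmetry of the archetype when
expressed in terms of reference maps at `γ a` and `γ b`. Transport is a relation between the values
of parallel fields defined on all of `[0, 1]`, so that `b < a` is allowed. -/
def DefectBody.IsTransportSymmetry (B : DefectBody.{u, w} M 𝒲) (D : Conn d M) (γ : ℝ → M)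
    (a b : ℝ) : Prop :=
  ∀ α β, γ a ∈ B.U α → γ b ∈ B.U β → ∃ g ∈ symmetryGroup 𝒲, ∀ V : ℝ → TangentBundle (𝓡 d) M,
    (∀ t ∈ Icc (0 : ℝ) 1, (V t).proj = γ t) → Piecewise (IsParallelOn D V) →
    B.P β (V b).proj (V b).snd = (g : Euc d →L[ℝ] Euc d) (B.P α (V a).proj (V a).snd)

theorem DefectBody.IsTransportSymmetry.symm {B : DefectBody.{u, w} M 𝒲} {γ : ℝ → M} {a b : ℝ}
    (hab : B.IsTransportSymmetry D γ a b) : B.IsTransportSymmetry D γ b a := by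
  intro β α hβ hα
  obtain ⟨g, hg, g_apply⟩ := hab α β hα hβ
  refine ⟨g⁻¹, inv_mem hg, fun V hVγ hV => ?_⟩
  rw [g_apply V hVγ hV]
  exact (DFunLike.congr_fun g.inv_mul _).symm

theorem DefectBody.IsTransportSymmetry.trans {B : DefectBody.{u, w} M 𝒲} {γ : ℝ → M} {a b c : ℝ}
    (hab : B.IsTransportSymmetry D γ a b) (hbc : B.IsTransportSymmetry D γ b c)
    (hb : γ b ∈ B.carrier) : B.IsTransportSymmetry D γ a c := by
  intro α β hα hβ
  obtain ⟨δ, hδ⟩ := mem_iUnion.1 (B.iUnion_U.symm ▸ hb)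
  obtain ⟨g, hg, g_apply⟩ := hab α δ hα hδ
  obtain ⟨k, hk, k_apply⟩ := hbc δ β hδ hβ
  refine ⟨k * g, mul_mem hk hg, fun V hVγ hV => ?_⟩
  rw [k_apply V hVγ hV, g_apply V hVγ hV]
  rfl

theorem DefectBody.isTransportSymmetry_of_mapsTo (B : DefectBody.{u, w} M 𝒲)
    (h𝒲 : IsUndistorted 𝒲) (hD : B.IsLeviCivita D) {γ : ℝ → M} {δ : B.ι} {a b : ℝ}
    (ha : a ∈ Icc (0 : ℝ) 1) (hb : b ∈ Icc (0 : ℝ) 1) (hγ : MapsTo γ (uIcc a b) (B.U δ)) :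
    B.IsTransportSymmetry D γ a b := by
  intro α β hα hβ
  obtain ⟨g, hg, g_apply⟩ := B.exists_transition hα (hγ left_mem_uIcc)
  obtain ⟨k, hk, k_apply⟩ := B.exists_transition (hγ right_mem_uIcc) hβ
  refine ⟨k * g, mul_mem hk hg, fun V hVγ hV => ?_⟩
  have apply_eq := B.P_apply_eq_of_isParallelOn h𝒲 hD hV ha hb fun t ht =>
    (hVγ t (uIcc_subset_Icc ha hb ht)).symm ▸ hγ ht
  rw [← hVγ a ha] at g_apply
  rw [← hVγ b hb] at k_apply
  rw [← k_apply, apply_eq, ← g_apply]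
  rfl

theorem DefectBody.isTransportSymmetry (B : DefectBody.{u, w} M 𝒲) (h𝒲 : IsUndistorted 𝒲)
    (hD : B.IsLeviCivita D) {γ : ℝ → M} (hγ : ContinuousOn γ (Icc 0 1))
    (hγB : MapsTo γ (Icc 0 1) B.carrier) {a b : ℝ} (ha : a ∈ Icc (0 : ℝ) 1)
    (hb : b ∈ Icc (0 : ℝ) 1) : B.IsTransportSymmetry D γ a b := by
  refine isPreconnected_Icc.induction₂ (B.IsTransportSymmetry D γ) (fun x hx => ?_)
    (fun _ y _ _ hy _ hxy hyz => hxy.trans hyz (hγB hy)) (fun _ _ _ _ hxy => hxy.symm) ha hb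
  obtain ⟨δ, hδ⟩ := mem_iUnion.1 (B.iUnion_U.symm ▸ hγB hx)
  have uIcc_tendsto : Tendsto (uIcc x) (𝓝[Icc 0 1] x) (𝓝[Icc 0 1] x).smallSets :=
    (tendsto_const_pure.mono_right (pure_le_nhdsWithin hx)).uIcc tendsto_id
  filter_upwards [self_mem_nhdsWithin, tendsto_smallSets_iff.1 uIcc_tendsto _
    ((hγ x hx).preimage_mem_nhdsWithin ((B.isOpen_U δ).mem_nhds hδ))] with y hy hxy
  exact B.isTransportSymmetry_of_mapsTo h𝒲 hD hx hy hxy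

theorem DefectBody.exists_symmetry_of_isParallelTransport (B : DefectBody.{u, w} M 𝒲)
    (h𝒲 : IsUndistorted 𝒲) (hD : B.IsLeviCivita D) {γ : ℝ → M} {p : M}
    (hγ : IsClosedCurve d γ p) (hγB : MapsTo γ (Icc 0 1) B.carrier)
    {c : TangentSpace (𝓡 d) p →L[ℝ] TangentSpace (𝓡 d) p} (hc : IsParallelTransport D γ c)
    {α : B.ι} (hα : p ∈ B.U α) :
    ∃ g ∈ symmetryGroup 𝒲, ∀ v, B.P α p (c v) = (g : Euc d →L[ℝ] Euc d) (B.P α p v) := by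
  obtain ⟨g, hg, g_apply⟩ := B.isTransportSymmetry h𝒲 hD hγ.continuousOn hγB
    (left_mem_Icc.2 zero_le_one) (right_mem_Icc.2 zero_le_one) α α
    (hγ.1.symm ▸ hα) (hγ.2.1.symm ▸ hα)
  refine ⟨g, hg, fun v => ?_⟩
  obtain ⟨V, hVγ, V_zero, V_one, hV⟩ := hc v
  have apply_eq := g_apply V hVγ hV
  rwa [V_zero, V_one] at apply_eq

theorem exists_disclination_gap (h𝒲 : IsUndistorted 𝒲)
    (discrete : DiscreteTopology (symmetryGroup 𝒲)) :
    ∃ ε : ℝ, 0 < ε ∧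
      ∀ (M : Type u) [TopologicalSpace M] [ChartedSpace (Euc d) M] [IsManifold (𝓡 d) ∞ M]
        (B : DefectBody.{u, w} M 𝒲) (γ : ℝ → M) (p : M)
        (c : TangentSpace (𝓡 d) p →L[ℝ] TangentSpace (𝓡 d) p),
        B.IsDisclinationContent γ c →
          c = ContinuousLinearMap.id ℝ (TangentSpace (𝓡 d) p) ∨
          ∀ α : B.ι, p ∈ B.U α →
            ε ≤ ‖(B.P α p ∘L c ∘L (B.P α p).inverse) - ContinuousLinearMap.id ℝ (Euc d)‖ := by
  obtain ⟨ε, hε, gap⟩ := exists_forall_le_norm_val_sub_one (symmetryGroup 𝒲)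
  refine ⟨ε, hε, fun M _ _ _ B γ p c ⟨hγ, hγB, D, hD, hc⟩ => or_iff_not_imp_left.2
    fun c_ne_id α hα => ?_⟩
  obtain ⟨g, hg, g_apply⟩ := B.exists_symmetry_of_isParallelTransport h𝒲 hD hγ hγB hc hα
  obtain ⟨e, he⟩ := B.P_invertible α p hα
  rw [← he] at g_apply ⊢
  have conj_eq : (e : TangentSpace (𝓡 d) p →L[ℝ] Euc d) ∘L c ∘L
      (e : TangentSpace (𝓡 d) p →L[ℝ] Euc d).inverse = (g : Euc d →L[ℝ] Euc d) := by
    ext1 v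
    rw [ContinuousLinearMap.inverse_equiv]
    exact (g_apply _).trans (congrArg _ (e.apply_symm_apply v))
  rw [conj_eq]
  refine (gap g hg).resolve_left fun g_eq_one => c_ne_id ?_
  ext1 v
  refine e.injective ((g_apply v).trans ?_)
  rw [g_eq_one]
  rfl

end Disclinations

section ChartCoframe

variable {d : ℕ} {M : Type u} [TopologicalSpace M] [ChartedSpace (Euc d) M]
  [IsManifold (𝓡 d) ∞ M]

/-- The trivialization of the tangent bundle given by the chart at `p`. -/
noncomputable abbrev chartTriv (p : M) :
    Trivialization (Euc d) (π (Euc d) (TangentSpace (𝓡 d) : M → Type)) :=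
  trivializationAt (Euc d) (TangentSpace (𝓡 d)) p

/-- The differential of the chart at `p`, as a coframe. -/
noncomputable def chartCoframe (p x : M) : TangentSpace (𝓡 d) x →L[ℝ] Euc d :=
  (chartTriv p).continuousLinearMapAt ℝ x

/-- The coordinate frame of the chart at `p`. -/
noncomputable def chartFrame (p x : M) : Euc d →L[ℝ] TangentSpace (𝓡 d) x :=
  (chartTriv p).symmL ℝ x

variable {p x : M}

theorem chartTriv_baseSet_mem_nhds (p : M) : (chartTriv (d := d) p).baseSet ∈ 𝓝 p :=
  (chartTriv p).open_baseSet.mem_nhds (FiberBundle.mem_baseSet_trivializationAt' p)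

theorem extChartAt_symm_mem_baseSet {u : Euc d} (hu : u ∈ (extChartAt (𝓡 d) p).target) :
    (extChartAt (𝓡 d) p).symm u ∈ (chartTriv (d := d) p).baseSet := by
  rw [TangentBundle.trivializationAt_baseSet, ← extChartAt_source (𝓡 d)]
  exact (extChartAt (𝓡 d) p).map_target hu

theorem chartCoframe_apply (hx : x ∈ (chartTriv (d := d) p).baseSet) (v : TangentSpace (𝓡 d) x) :
    chartCoframe p x v = (chartTriv p ⟨x, v⟩).2 := by
  rw [chartCoframe, Trivialization.continuousLinearMapAt_apply,
    Trivialization.coe_linearMapAt_of_mem _ hx]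

theorem chartCoframe_self (p : M) (v : TangentSpace (𝓡 d) p) : chartCoframe p p v = v :=
  (chartCoframe_apply (FiberBundle.mem_baseSet_trivializationAt' p) v).trans
    (trivializationAt_self_apply p v)

theorem chartCoframe_chartFrame (hx : x ∈ (chartTriv (d := d) p).baseSet) (v : Euc d) :
    chartCoframe p x (chartFrame p x v) = v :=
  Trivialization.continuousLinearMapAt_symmL _ hx v

theorem chartFrame_chartCoframe (hx : x ∈ (chartTriv (d := d) p).baseSet)
    (v : TangentSpace (𝓡 d) x) : chartFrame p x (chartCoframe p x v) = v :=
  Trivialization.symmL_continuousLinearMapAt _ hx v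

theorem chartCoframe_eq_mfderiv (hx : x ∈ (chartTriv (d := d) p).baseSet) :
    chartCoframe (d := d) p x = mfderiv (𝓡 d) 𝓘(ℝ, Euc d) (extChartAt (𝓡 d) p) x :=
  TangentBundle.continuousLinearMapAt_trivializationAt
    (by rwa [TangentBundle.trivializationAt_baseSet] at hx)

theorem isCoframeOn_chartCoframe (p : M) :
    IsCoframeOn (d := d) (chartCoframe p) (chartTriv (d := d) p).baseSet where
  isInvertible x hx := ContinuousLinearMap.IsInvertible.of_inverse (g := chartFrame p x)
    (ContinuousLinearMap.ext fun v => chartCoframe_chartFrame hx v)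
    (ContinuousLinearMap.ext fun v => chartFrame_chartCoframe hx v)
  mdifferentiableAt x hx := by
    refine (mdifferentiableAt_coordChangeL (IB := 𝓡 d)
      (FiberBundle.mem_baseSet_trivializationAt' x) hx).congr_of_eventuallyEq ?_
    filter_upwards [chartTriv_baseSet_mem_nhds (d := d) x, (chartTriv p).open_baseSet.mem_nhds hx]
      with y hxy hpy
    ext1 v
    simp only [ContinuousLinearMap.comp_apply, ContinuousLinearEquiv.coe_coe]
    rw [Trivialization.coordChangeL_apply _ _ ⟨hxy, hpy⟩, Trivialization.symmL_apply _ hxy,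
      chartCoframe_apply hpy]

theorem contMDiffOn_chartFrame (p : M) (v : Euc d) :
    ContMDiffOn (𝓡 d) (𝓡 d).tangent ∞
      (fun x => (⟨x, chartFrame p x v⟩ : TangentBundle (𝓡 d) M)) (chartTriv (d := d) p).baseSet :=
  ((chartTriv p).contMDiffOn_section_baseSet_iff (IB := 𝓡 d) (n := ∞)).2 <|
    (contMDiffOn_const (c := v)).congr fun _ hx =>
      (chartCoframe_apply hx _).symm.trans (chartCoframe_chartFrame hx v)

theorem mdifferentiableAt_chartFrame (hx : x ∈ (chartTriv (d := d) p).baseSet) (v : Euc d) :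
    MDifferentiableAt (𝓡 d) (𝓡 d).tangent
      (fun x => (⟨x, chartFrame p x v⟩ : TangentBundle (𝓡 d) M)) x :=
  ((contMDiffOn_chartFrame p v).contMDiffAt
    ((chartTriv p).open_baseSet.mem_nhds hx)).mdifferentiableAt (by simp)

variable {D : Conn d M}

/-- The Christoffel symbols of `D` in the chart at `p`, at the point `x` of `M`. The second argument
is the direction. -/
noncomputable def christoffelAt (hD : IsCovariantDerivativeOn (Euc d) D univ) (p x : M) :
    Euc d →L[ℝ] Euc d →L[ℝ] Euc d :=
  (chartFrame p x).precomp (Euc d) ∘L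
    connectionForm (hD.mono (subset_univ _)) (isCoframeOn_chartCoframe p) x ∘L chartFrame p x

theorem connectionForm_chartCoframe (hD : IsCovariantDerivativeOn (Euc d) D univ)
    (hx : x ∈ (chartTriv (d := d) p).baseSet) (v w : TangentSpace (𝓡 d) x) :
    connectionForm (hD.mono (subset_univ _)) (isCoframeOn_chartCoframe p) x v w =
      christoffelAt hD p x (chartCoframe p x v) (chartCoframe p x w) := by
  simp only [christoffelAt, ContinuousLinearMap.comp_apply, ContinuousLinearMap.precomp_apply,
    chartFrame_chartCoframe hx]

theorem chartCoframe_conn (hD : IsCovariantDerivativeOn (Euc d) D univ)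
    (hx : x ∈ (chartTriv (d := d) p).baseSet) {σ : (q : M) → TangentSpace (𝓡 d) q}
    (hσ : MDifferentiableAt (𝓡 d) (𝓡 d).tangent
      (fun q => (⟨q, σ q⟩ : TangentBundle (𝓡 d) M)) x) (w : TangentSpace (𝓡 d) x) :
    chartCoframe p x (D σ x w) = mvfderiv (𝓡 d) (fun q => chartCoframe p q (σ q)) x w
      + christoffelAt hD p x (chartCoframe p x (σ x)) (chartCoframe p x w) := by
  rw [← connectionForm_chartCoframe hD hx,
    connectionForm_apply (hD.mono (subset_univ _)) (isCoframeOn_chartCoframe p) hx hσ,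
    add_sub_cancel]

theorem chartCoframe_conn_chartFrame (hD : IsCovariantDerivativeOn (Euc d) D univ)
    (hx : x ∈ (chartTriv (d := d) p).baseSet) (v w : Euc d) :
    chartCoframe p x (D (fun q => chartFrame p q v) x (chartFrame p x w))
      = christoffelAt hD p x v w := by
  have eventually_const : (fun q => chartCoframe p q (chartFrame p q v)) =ᶠ[𝓝 x] fun _ => v :=
    Filter.mem_of_superset ((chartTriv p).open_baseSet.mem_nhds hx)
      fun _ hq => chartCoframe_chartFrame hq v
  have mvfderiv_eq_zero : mvfderiv (𝓡 d) (fun q => chartCoframe p q (chartFrame p q v)) x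
      (chartFrame p x w) = 0 := by
    rw [mvfderiv, eventually_const.mfderiv_eq, mfderiv_const]
    rfl
  rw [chartCoframe_conn hD hx (mdifferentiableAt_chartFrame hx v), chartCoframe_chartFrame hx,
    chartCoframe_chartFrame hx, mvfderiv_eq_zero, zero_add]

theorem IsParallelOn.hasDerivWithinAt_chart (hD : IsCovariantDerivativeOn (Euc d) D univ)
    {V : ℝ → TangentBundle (𝓡 d) M} {J : Set ℝ} (hV : IsParallelOn D V J) {t : ℝ} (ht : t ∈ J)
    (hp : (V t).proj ∈ (chartTriv (d := d) p).baseSet) (hJ : UniqueDiffWithinAt ℝ J t) {b : Euc d}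
    (hb : HasDerivWithinAt (fun τ => extChartAt (𝓡 d) p (V τ).proj) b J t) :
    HasDerivWithinAt (fun τ => chartCoframe p (V τ).proj (V τ).snd)
      (-christoffelAt hD p (V t).proj (chartCoframe p (V t).proj (V t).snd) b) J t := by
  have mdifferentiable_curve : MDifferentiableWithinAt 𝓘(ℝ, ℝ) (𝓡 d) (fun τ => (V τ).proj) J t :=
    (hV.1 t ht).mdifferentiableWithinAt (by simp)
  have chartCoframe_velocity : chartCoframe p (V t).proj
      (mfderivWithin 𝓘(ℝ, ℝ) (𝓡 d) (fun τ => (V τ).proj) J t (1 : ℝ)) = b := by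
    have hasMFDerivWithinAt_chart : HasMFDerivWithinAt 𝓘(ℝ, ℝ) 𝓘(ℝ, Euc d)
        (extChartAt (𝓡 d) p ∘ fun τ => (V τ).proj) J t
        (mfderiv (𝓡 d) 𝓘(ℝ, Euc d) (extChartAt (𝓡 d) p) (V t).proj ∘L
          mfderivWithin 𝓘(ℝ, ℝ) (𝓡 d) (fun τ => (V τ).proj) J t) :=
      HasMFDerivAt.comp_hasMFDerivWithinAt t (mdifferentiableAt_extChartAt
        (by rwa [TangentBundle.trivializationAt_baseSet] at hp)).hasMFDerivAt
        mdifferentiable_curve.hasMFDerivWithinAt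
    have hasFDerivWithinAt_chart : HasFDerivWithinAt (fun τ => extChartAt (𝓡 d) p (V τ).proj)
        (mfderiv (𝓡 d) 𝓘(ℝ, Euc d) (extChartAt (𝓡 d) p) (V t).proj ∘L
          mfderivWithin 𝓘(ℝ, ℝ) (𝓡 d) (fun τ => (V τ).proj) J t : ℝ →L[ℝ] Euc d) J t :=
      hasMFDerivWithinAt_chart.hasFDerivWithinAt
    rw [chartCoframe_eq_mfderiv hp]
    exact hJ.eq_deriv _ hasFDerivWithinAt_chart.hasDerivWithinAt hb
  refine (hV.hasDerivWithinAt_coframe ht (hD.mono (subset_univ _)) (isCoframeOn_chartCoframe p)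
    hp).congr_deriv ?_
  rw [connectionForm_chartCoframe hD hp, chartCoframe_velocity]

end ChartCoframe

section CovDeriv

variable {E : Type*} [NormedAddCommGroup E] [NormedSpace ℝ E] {Γ : E → E →L[ℝ] E →L[ℝ] E}
  {ξ η ζ ζ' : E → E} {u : E}

/-- The covariant derivative of the vector field `ζ` in the direction of `η`, for the connection on
a vector space with Christoffel form `Γ`; the second argument of `Γ u` is the direction. -/
noncomputable def covDeriv (Γ : E → E →L[ℝ] E →L[ℝ] E) (ζ η : E → E) (u : E) : E :=
  fderiv ℝ ζ u (η u) + Γ u (ζ u) (η u)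

theorem covDeriv_congr (h : ζ =ᶠ[𝓝 u] ζ') : covDeriv Γ ζ η u = covDeriv Γ ζ' η u := by
  rw [covDeriv, covDeriv, h.fderiv_eq, h.eq_of_nhds]

theorem fderiv_covDeriv (hΓ : DifferentiableAt ℝ Γ u) (hζ : ContDiffAt ℝ 2 ζ u)
    (hη : DifferentiableAt ℝ η u) (v : E) :
    fderiv ℝ (covDeriv Γ ζ η) u v =
      fderiv ℝ (fderiv ℝ ζ) u v (η u) + fderiv ℝ ζ u (fderiv ℝ η u v)
        + (fderiv ℝ Γ u v (ζ u) (η u) + Γ u (fderiv ℝ ζ u v) (η u)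
          + Γ u (ζ u) (fderiv ℝ η u v)) := by
  have differentiableAt_fderiv : DifferentiableAt ℝ (fderiv ℝ ζ) u :=
    (hζ.fderiv_right (m := 1) (by norm_num)).differentiableAt (by norm_num)
  have hasFDerivAt_covDeriv :=
    (differentiableAt_fderiv.hasFDerivAt.clm_apply hη.hasFDerivAt).fun_add
    ((hΓ.hasFDerivAt.clm_apply (hζ.differentiableAt (by norm_num)).hasFDerivAt).clm_apply
      hη.hasFDerivAt)
  rw [HasFDerivAt.fderiv (f := covDeriv Γ ζ η) hasFDerivAt_covDeriv]
  simp only [add_apply, ContinuousLinearMap.comp_apply, ContinuousLinearMap.flip_apply]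
  abel

theorem covDeriv_covDeriv_sub (hΓ : DifferentiableAt ℝ Γ u) (hξ : DifferentiableAt ℝ ξ u)
    (hη : DifferentiableAt ℝ η u) (hζ : ContDiffAt ℝ 2 ζ u) :
    covDeriv Γ (covDeriv Γ ζ η) ξ u - covDeriv Γ (covDeriv Γ ζ ξ) η u
      - covDeriv Γ ζ (VectorField.lieBracket ℝ ξ η) u
      = curvatureForm (Γ u) (fderiv ℝ Γ u) (ξ u) (η u) (ζ u) := by
  have second_derivative_symm :
      fderiv ℝ (fderiv ℝ ζ) u (ξ u) (η u) = fderiv ℝ (fderiv ℝ ζ) u (η u) (ξ u) :=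
    hζ.isSymmSndFDerivAt (by simp) (ξ u) (η u)
  rw [covDeriv, fderiv_covDeriv hΓ hζ hη, covDeriv, covDeriv, fderiv_covDeriv hΓ hζ hξ,
    second_derivative_symm, curvatureForm_apply]
  simp only [covDeriv, VectorField.lieBracket, map_add, map_sub, add_apply]
  abel

end CovDeriv

section Coordinates

variable {d : ℕ} {M : Type u} [TopologicalSpace M] [ChartedSpace (Euc d) M]
  [IsManifold (𝓡 d) ∞ M] {p : M} {u : Euc d} {X Y Z : (x : M) → TangentSpace (𝓡 d) x}

/-- The components of the vector field `Z` in the chart at `p`, as functions of the coordinates. -/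
noncomputable def coordField (p : M) (Z : (x : M) → TangentSpace (𝓡 d) x) (u : Euc d) : Euc d :=
  chartCoframe p ((extChartAt (𝓡 d) p).symm u) (Z ((extChartAt (𝓡 d) p).symm u))

theorem coordField_self (p : M) (Z : (x : M) → TangentSpace (𝓡 d) x) :
    coordField p Z (extChartAt (𝓡 d) p p) = Z p := by
  rw [coordField, extChartAt_to_inv, chartCoframe_self]

theorem contDiffAt_coordField {n : WithTop ℕ∞} (hn : n ≤ ∞) (hu : u ∈ (extChartAt (𝓡 d) p).target)
    (hZ : ContMDiff (𝓡 d) (𝓡 d).tangent ∞ (fun q => (⟨q, Z q⟩ : TangentBundle (𝓡 d) M))) :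
    ContDiffAt ℝ n (coordField p Z) u := by
  have hx := extChartAt_symm_mem_baseSet hu
  have contMDiffAt_components : ContMDiffAt (𝓡 d) 𝓘(ℝ, Euc d) ∞ (fun x => chartCoframe p x (Z x))
      ((extChartAt (𝓡 d) p).symm u) :=
    (((chartTriv p).contMDiffAt_section_iff (IB := 𝓡 d) hx).1 (hZ _)).congr_of_eventuallyEq <|
      Filter.mem_of_superset ((chartTriv p).open_baseSet.mem_nhds hx)
        fun y hy => chartCoframe_apply hy (Z y)
  have contMDiffAt_symm : ContMDiffAt 𝓘(ℝ, Euc d) (𝓡 d) ∞ (extChartAt (𝓡 d) p).symm u :=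
    (contMDiffOn_extChartAt_symm p).contMDiffAt ((isOpen_extChartAt_target p).mem_nhds hu)
  exact (ContMDiffAt.comp u contMDiffAt_components contMDiffAt_symm).contDiffAt.of_le hn

theorem mpullbackWithin_extChartAt_symm (hu : u ∈ (extChartAt (𝓡 d) p).target)
    (Z : (x : M) → TangentSpace (𝓡 d) x) :
    VectorField.mpullbackWithin 𝓘(ℝ, Euc d) (𝓡 d) (extChartAt (𝓡 d) p).symm Z (range (𝓡 d)) u
      = coordField p Z u := by
  rw [VectorField.mpullbackWithin_apply, coordField,
    chartCoframe_eq_mfderiv (extChartAt_symm_mem_baseSet hu),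
    ContinuousLinearMap.inverse_eq (mfderivWithin_extChartAt_symm_comp_mfderiv_extChartAt hu)
      (mfderiv_extChartAt_comp_mfderivWithin_extChartAt_symm hu)]
  rfl

theorem inverse_mfderiv_extChartAt_self (p : M) (v : Euc d) :
    (mfderiv (𝓡 d) 𝓘(ℝ, Euc d) (extChartAt (𝓡 d) p) p).inverse v = v :=
  (congrArg (fun L : Euc d →L[ℝ] Euc d => L.inverse v) mfderiv_extChartAt_self).trans
    (congrArg (fun L : Euc d →L[ℝ] Euc d => L v) ContinuousLinearMap.inverse_id)

theorem mlieBracket_eq_lieBracket_coordField :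
    (VectorField.mlieBracket (𝓡 d) X Y p : Euc d) =
      VectorField.lieBracket ℝ (coordField p X) (coordField p Y) (extChartAt (𝓡 d) p p) := by
  have eventuallyEq_coordField (Z : (x : M) → TangentSpace (𝓡 d) x) :
      VectorField.mpullbackWithin 𝓘(ℝ, Euc d) (𝓡 d) (extChartAt (𝓡 d) p).symm Z (range (𝓡 d))
        =ᶠ[𝓝 (extChartAt (𝓡 d) p p)] coordField p Z :=
    Filter.mem_of_superset (extChartAt_target_mem_nhds p)
      fun u hu => mpullbackWithin_extChartAt_symm hu Z
  have preimage_inter_eq_univ : (extChartAt (𝓡 d) p).symm ⁻¹' univ ∩ range (𝓡 d) = univ := by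
    rw [preimage_univ, univ_inter, ModelWithCorners.range_eq_univ]
  have mlieBracket_apply := VectorField.mlieBracketWithin_apply (I := 𝓡 d) (V := X) (W := Y)
    (s := univ) (x₀ := p)
  rw [VectorField.mlieBracketWithin_univ, preimage_inter_eq_univ] at mlieBracket_apply
  exact mlieBracket_apply.trans <| (inverse_mfderiv_extChartAt_self p _).trans <|
    (congrFun (VectorField.lieBracketWithin_univ (𝕜 := ℝ) (E := Euc d)) _).trans <|
    (eventuallyEq_coordField X).lieBracket_vectorField_eq (eventuallyEq_coordField Y)

theorem mvfderiv_extChartAt_symm {F : Type*} [NormedAddCommGroup F] [NormedSpace ℝ F] {f : M → F}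
    (hu : u ∈ (extChartAt (𝓡 d) p).target)
    (hf : DifferentiableAt ℝ (fun z => f ((extChartAt (𝓡 d) p).symm z)) u)
    (w : TangentSpace (𝓡 d) ((extChartAt (𝓡 d) p).symm u)) :
    mvfderiv (𝓡 d) f ((extChartAt (𝓡 d) p).symm u) w =
      fderiv ℝ (fun z => f ((extChartAt (𝓡 d) p).symm z)) u
        (chartCoframe p ((extChartAt (𝓡 d) p).symm u) w) := by
  set φ := extChartAt (𝓡 d) p
  have hx : φ.symm u ∈ (chartAt (Euc d) p).source :=
    extChartAt_source (𝓡 d) p ▸ φ.map_target hu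
  rw [← φ.right_inv hu] at hf
  have eventuallyEq_comp : f =ᶠ[𝓝 (φ.symm u)] (fun z => f (φ.symm z)) ∘ φ :=
    Filter.mem_of_superset (extChartAt_source_mem_nhds' (by rwa [extChartAt_source]))
      fun q hq => (congrArg f (φ.left_inv hq)).symm
  have hasMFDerivAt_comp := (HasMFDerivAt.comp (φ.symm u) hf.hasFDerivAt.hasMFDerivAt
    (mdifferentiableAt_extChartAt (I := 𝓡 d) hx).hasMFDerivAt).congr_of_eventuallyEq
      eventuallyEq_comp
  rw [mvfderiv, hasMFDerivAt_comp.mfderiv, φ.right_inv hu,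
    chartCoframe_eq_mfderiv (extChartAt_symm_mem_baseSet hu)]
  rfl

/-- The Christoffel symbols of `D` in the chart at `p`, as functions of the coordinates. -/
noncomputable def christoffel {D : Conn d M} (hD : IsCovariantDerivativeOn (Euc d) D univ) (p : M)
    (u : Euc d) : Euc d →L[ℝ] Euc d →L[ℝ] Euc d :=
  christoffelAt hD p ((extChartAt (𝓡 d) p).symm u)

theorem coordField_conn {D : Conn d M} (hD : IsCovariantDerivativeOn (Euc d) D univ)
    (hu : u ∈ (extChartAt (𝓡 d) p).target)
    (hZ : ContMDiff (𝓡 d) (𝓡 d).tangent ∞ (fun q => (⟨q, Z q⟩ : TangentBundle (𝓡 d) M)))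
    (Y : (x : M) → TangentSpace (𝓡 d) x) :
    coordField p (fun q => D Z q (Y q)) u =
      covDeriv (christoffel hD p) (coordField p Z) (coordField p Y) u :=
  (chartCoframe_conn hD (extChartAt_symm_mem_baseSet hu) ((hZ _).mdifferentiableAt (by simp))
    _).trans <| congrArg (· + _) <| mvfderiv_extChartAt_symm hu
      ((contDiffAt_coordField le_rfl hu hZ).differentiableAt (by simp)) _

end Coordinates

theorem differentiableAt_clm_of_forall_apply {E F G : Type*} [NormedAddCommGroup E]
    [NormedSpace ℝ E] [NormedAddCommGroup F] [NormedSpace ℝ F] [NormedAddCommGroup G]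
    [NormedSpace ℝ G] [FiniteDimensional ℝ F] {f : E → F →L[ℝ] G} {x : E}
    (h : ∀ v, DifferentiableAt ℝ (fun u => f u v) x) : DifferentiableAt ℝ f x := by
  obtain ⟨n, b, e, he⟩ := exists_continuousLinearEquiv_pi_apply_eq F G
  rw [← e.comp_differentiableAt_iff, differentiableAt_pi]
  simpa only [Function.comp_apply, he] using fun i => h (b i)

section Curvature

variable {d : ℕ} {M : Type u} [TopologicalSpace M] [ChartedSpace (Euc d) M]
  [IsManifold (𝓡 d) ∞ M]

theorem exists_contMDiff_eventuallyEq_chartFrame [T2Space M] (p : M) (v : Euc d) :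
    ∃ σ : (x : M) → TangentSpace (𝓡 d) x,
      ContMDiff (𝓡 d) (𝓡 d).tangent ∞ (fun x => (⟨x, σ x⟩ : TangentBundle (𝓡 d) M)) ∧
      ∀ᶠ x in 𝓝 p, σ x = chartFrame p x v := by
  obtain ⟨f⟩ : Nonempty (SmoothBumpFunction (𝓡 d) p) := inferInstance
  refine ⟨(f : M → ℝ) • fun x => chartFrame p x v, ?_, ?_⟩
  · exact ContMDiffOn.smul_section_of_tsupport f.contMDiff.contMDiffOn (chartTriv p).open_baseSet
      (by rw [TangentBundle.trivializationAt_baseSet]; exact f.tsupport_subset_chartAt_source)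
      (contMDiffOn_chartFrame p v)
  · filter_upwards [f.eventuallyEq_one] with x hx
    change f x • chartFrame p x v = chartFrame p x v
    rw [hx, Pi.one_apply, one_smul]

omit [IsManifold (𝓡 d) ∞ M] in
theorem differentiableAt_comp_extChartAt_symm {F : Type*} [NormedAddCommGroup F] [NormedSpace ℝ F]
    {f : M → F} {p : M} (hf : MDifferentiableAt (𝓡 d) 𝓘(ℝ, F) f p) :
    DifferentiableAt ℝ (fun u => f ((extChartAt (𝓡 d) p).symm u)) (extChartAt (𝓡 d) p p) := by
  have differentiableWithinAt :=
    (mdifferentiableWithinAt_univ.2 hf).differentiableWithinAt_comp_extChartAt_symm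
  rwa [preimage_univ, univ_inter, ModelWithCorners.range_eq_univ,
    differentiableWithinAt_univ] at differentiableWithinAt

variable {D : CovariantDerivative (𝓡 d) (Euc d) (TangentSpace (𝓡 d) : M → Type)}

theorem differentiableAt_christoffel [T2Space M]
    (hD : CovariantDerivative.ContMDiffCovariantDerivative D ∞) (p : M) :
    DifferentiableAt ℝ (christoffel (d := d) D.isCovariantDerivativeOnUniv p)
      (extChartAt (𝓡 d) p p) := by
  refine differentiableAt_clm_of_forall_apply fun v => differentiableAt_comp_extChartAt_symm
    (f := fun x => christoffelAt D.isCovariantDerivativeOnUniv p x v) ?_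
  obtain ⟨σ, hσ, σ_eq⟩ := exists_contMDiff_eventuallyEq_chartFrame p v
  have mdifferentiableAt_conn := ((mdifferentiableAt_hom_bundle _).1
    ((contMDiffOn_univ.1 (hD.contMDiff.contMDiff (σ := σ) hσ.contMDiffOn)).contMDiffAt (x := p)
      |>.mdifferentiableAt (by simp))).2
  refine mdifferentiableAt_conn.congr_of_eventuallyEq ?_
  filter_upwards [eventually_eventually_nhds.2 σ_eq, chartTriv_baseSet_mem_nhds (d := d) p]
    with x σ_eq_near hx
  have conn_eq : D σ x = D (fun q => chartFrame p q v) x :=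
    D.isCovariantDerivativeOnUniv.congr_of_eventuallyEq
      ((hσ x).mdifferentiableAt (by simp)) (mdifferentiableAt_chartFrame hx v) univ_mem σ_eq_near
  ext1 w
  change _ = chartCoframe p x (D σ x (chartFrame p x w))
  rw [conn_eq, chartCoframe_conn_chartFrame D.isCovariantDerivativeOnUniv hx]

variable {X Y Z : (x : M) → TangentSpace (𝓡 d) x}

theorem coordField_conn_conn (hD : CovariantDerivative.ContMDiffCovariantDerivative D ∞)
    (hY : ContMDiff (𝓡 d) (𝓡 d).tangent ∞ (fun q => (⟨q, Y q⟩ : TangentBundle (𝓡 d) M)))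
    (hZ : ContMDiff (𝓡 d) (𝓡 d).tangent ∞ (fun q => (⟨q, Z q⟩ : TangentBundle (𝓡 d) M)))
    (X : (x : M) → TangentSpace (𝓡 d) x) (p : M) :
    coordField p (fun q => D (fun r => D Z r (Y r)) q (X q)) (extChartAt (𝓡 d) p p) =
      covDeriv (christoffel D.isCovariantDerivativeOnUniv p)
        (covDeriv (christoffel D.isCovariantDerivativeOnUniv p) (coordField p Z) (coordField p Y))
        (coordField p X) (extChartAt (𝓡 d) p p) := by
  have contMDiff_conn : ContMDiff (𝓡 d) (𝓡 d).tangent ∞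
      (fun q => (⟨q, D Z q (Y q)⟩ : TangentBundle (𝓡 d) M)) :=
    ContMDiff.clm_bundle_apply (contMDiffOn_univ.1 (hD.contMDiff.contMDiff hZ.contMDiffOn)) hY
  rw [coordField_conn D.isCovariantDerivativeOnUniv (mem_extChartAt_target p) contMDiff_conn]
  exact covDeriv_congr <| Filter.mem_of_superset (extChartAt_target_mem_nhds p)
    fun u hu => coordField_conn D.isCovariantDerivativeOnUniv hu hZ Y

theorem curvature_eq_curvatureForm [T2Space M]
    (hD : CovariantDerivative.ContMDiffCovariantDerivative D ∞)
    (hX : ContMDiff (𝓡 d) (𝓡 d).tangent ∞ (fun q => (⟨q, X q⟩ : TangentBundle (𝓡 d) M)))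
    (hY : ContMDiff (𝓡 d) (𝓡 d).tangent ∞ (fun q => (⟨q, Y q⟩ : TangentBundle (𝓡 d) M)))
    (hZ : ContMDiff (𝓡 d) (𝓡 d).tangent ∞ (fun q => (⟨q, Z q⟩ : TangentBundle (𝓡 d) M))) (p : M) :
    (curvature (d := d) D X Y Z p : Euc d) =
      curvatureForm (christoffel (d := d) D.isCovariantDerivativeOnUniv p (extChartAt (𝓡 d) p p))
        (fderiv ℝ (christoffel (d := d) D.isCovariantDerivativeOnUniv p) (extChartAt (𝓡 d) p p))
        (X p) (Y p) (Z p) := by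
  have hΓ := differentiableAt_christoffel hD p
  have hp : extChartAt (𝓡 d) p p ∈ (extChartAt (𝓡 d) p).target := mem_extChartAt_target p
  have coordField_mlieBracket : coordField p (VectorField.mlieBracket (𝓡 d) X Y)
        (extChartAt (𝓡 d) p p) =
      VectorField.lieBracket ℝ (coordField p X) (coordField p Y) (extChartAt (𝓡 d) p p) :=
    (coordField_self p _).trans mlieBracket_eq_lieBracket_coordField
  have covDeriv_mlieBracket :=
    coordField_conn D.isCovariantDerivativeOnUniv hp hZ (VectorField.mlieBracket (𝓡 d) X Y)
  rw [covDeriv, coordField_mlieBracket, ← covDeriv] at covDeriv_mlieBracket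
  have coordinate_formula := covDeriv_covDeriv_sub hΓ
    ((contDiffAt_coordField le_rfl hp hX).differentiableAt (by simp))
    ((contDiffAt_coordField le_rfl hp hY).differentiableAt (by simp))
    (contDiffAt_coordField (n := 2) ENat.LEInfty.out hp hZ)
  rw [← covDeriv_mlieBracket, ← coordField_conn_conn hD hY hZ, ← coordField_conn_conn hD hX hZ]
    at coordinate_formula
  simp only [coordField_self] at coordinate_formula
  exact coordinate_formula

end Curvature

section ChartLoop

open Asymptotics

variable {d : ℕ} {M : Type u} [TopologicalSpace M] [ChartedSpace (Euc d) M] {p : M} {x y : Euc d}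
  {s : ℝ}

/-- The loop at `p` whose expression in the chart at `p` is `s • loop x y`. -/
noncomputable def chartLoop (p : M) (x y : Euc d) (s t : ℝ) : M :=
  (extChartAt (𝓡 d) p).symm (extChartAt (𝓡 d) p p + s • loop x y t)

theorem eventually_chartLoop_mem_target (p : M) (x y : Euc d) :
    ∀ᶠ s : ℝ in 𝓝[>] 0, ∀ t ∈ Icc (0 : ℝ) 1,
      extChartAt (𝓡 d) p p + s • loop x y t ∈ (extChartAt (𝓡 d) p).target := by
  refine nhdsWithin_le_nhds (isCompact_Icc.eventually_forall_of_forall_eventually fun t _ => ?_)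
  have continuous_curve : Continuous fun z : ℝ × ℝ => extChartAt (𝓡 d) p p + z.1 • loop x y z.2 :=
    continuous_const.add <| continuous_fst.smul <|
      (contDiff_loop x y (n := 0)).continuous.comp continuous_snd
  refine (continuous_curve.tendsto (0, t)).eventually ?_
  rw [zero_smul, add_zero]
  exact extChartAt_target_mem_nhds p

variable [IsManifold (𝓡 d) ∞ M]

theorem isClosedCurve_chartLoop (hs : ∀ t ∈ Icc (0 : ℝ) 1,
      extChartAt (𝓡 d) p p + s • loop x y t ∈ (extChartAt (𝓡 d) p).target) :
    IsClosedCurve d (chartLoop p x y s) p := by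
  have contMDiff_curve : ContMDiff 𝓘(ℝ, ℝ) 𝓘(ℝ, Euc d) ∞
      fun t => extChartAt (𝓡 d) p p + s • loop x y t :=
    (contDiff_const.add ((contDiff_loop x y).const_smul s)).contMDiff
  refine ⟨by simp [chartLoop], by simp [chartLoop], 1, fun i => i, by simp, by simp, ?_⟩
  intro i hi
  obtain rfl : i = 0 := Nat.lt_one_iff.1 hi
  refine ⟨by simp, ?_⟩
  exact (contMDiffOn_extChartAt_symm p).comp contMDiff_curve.contMDiffOn
    fun t ht => hs t (by simpa using ht)

theorem hasRightDerivOnIcc_chartCoframe {D : Conn d M}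
    (hD : IsCovariantDerivativeOn (Euc d) D univ)
    (hs : ∀ t ∈ Icc (0 : ℝ) 1,
      extChartAt (𝓡 d) p p + s • loop x y t ∈ (extChartAt (𝓡 d) p).target)
    {V : ℝ → TangentBundle (𝓡 d) M} (hV : Piecewise (IsParallelOn D V))
    (proj_eq : ∀ t ∈ Icc (0 : ℝ) 1, (V t).proj = chartLoop p x y s t) :
    HasRightDerivOnIcc (fun t => chartCoframe p (V t).proj (V t).snd)
      (fun t => -christoffel hD p (extChartAt (𝓡 d) p p + s • loop x y t)
        (chartCoframe p (V t).proj (V t).snd) (s • loopDeriv x y t)) 0 1 := by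
  refine hV.and_subset_unitInterval.hasRightDerivOnIcc le_rfl le_rfl ?_
  rintro a b hab ⟨subset_unit, hpar⟩ t ht ht_unit
  have coord_eq : ∀ τ ∈ Icc (0 : ℝ) 1,
      extChartAt (𝓡 d) p (V τ).proj = extChartAt (𝓡 d) p p + s • loop x y τ := fun τ hτ => by
    rw [proj_eq τ hτ, chartLoop, (extChartAt (𝓡 d) p).right_inv (hs τ hτ)]
  have coord_deriv : HasDerivWithinAt (fun τ => extChartAt (𝓡 d) p (V τ).proj)
      (s • loopDeriv x y t) (Icc a b) t :=
    (((hasDerivAt_loop x y t).const_smul s).const_add _).hasDerivWithinAt.congr_of_mem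
      (fun τ hτ => coord_eq τ (subset_unit hτ)) ht
  have mem_baseSet : (V t).proj ∈ (chartTriv (d := d) p).baseSet :=
    proj_eq t ht_unit ▸ extChartAt_symm_mem_baseSet (hs t ht_unit)
  have coframe_deriv :=
    hpar.hasDerivWithinAt_chart hD ht mem_baseSet (uniqueDiffOn_Icc hab t ht) coord_deriv
  have base_eq : (extChartAt (𝓡 d) p).symm (extChartAt (𝓡 d) p p + s • loop x y t) = (V t).proj :=
    (proj_eq t ht_unit).symm
  rwa [christoffel, base_eq]

theorem isParallelFamily_chartCoframe {D : Conn d M}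
    (hD : IsCovariantDerivativeOn (Euc d) D univ) {v : Euc d} {V : ℝ → ℝ → TangentBundle (𝓡 d) M}
    (hV : ∀ᶠ s in 𝓝[>] (0 : ℝ), V s 0 = ⟨p, v⟩ ∧ Piecewise (IsParallelOn D (V s)) ∧
      ∀ t ∈ Icc (0 : ℝ) 1, (V s t).proj = chartLoop p x y s t) :
    IsParallelFamily (𝓝[>] 0) (christoffel hD p) (extChartAt (𝓡 d) p p) id (loop x y)
      (loopDeriv x y) v fun s t => chartCoframe p (V s t).proj (V s t).snd := by
  filter_upwards [hV, eventually_chartLoop_mem_target p x y] with s ⟨start_eq, hpar, proj_eq⟩ hs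
  exact ⟨by rw [start_eq, chartCoframe_self],
    hasRightDerivOnIcc_chartCoframe hD hs hpar proj_eq⟩

theorem isParallelTransport_chartLoop_isLittleO {D : Conn d M}
    (hD : IsCovariantDerivativeOn (Euc d) D univ)
    (hΓ : DifferentiableAt ℝ (christoffel hD p) (extChartAt (𝓡 d) p p))
    {h : ℝ → Euc d →L[ℝ] Euc d}
    (hh : ∀ᶠ s in 𝓝[>] 0, IsParallelTransport (p := p) (q := p) D (chartLoop p x y s) (h s)) :
    (fun s => h s - 1 - s ^ 2 • (-1 / 60 : ℝ) • curvatureForm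
        (christoffel hD p (extChartAt (𝓡 d) p p))
        (fderiv ℝ (christoffel hD p) (extChartAt (𝓡 d) p p)) x y)
      =o[𝓝[>] 0] fun s => s ^ 2 := by
  refine isLittleO_clm_of_forall_apply fun v => ?_
  obtain ⟨V, hV⟩ := (hh.mono fun s hs => hs v).choice
  have parallel := isParallelFamily_chartCoframe hD
    (hV.mono fun s ⟨proj_eq, start_eq, _, hpar⟩ => ⟨start_eq, hpar, proj_eq⟩)
  refine (parallel.sub_add_curvatureForm_isLittleO hΓ.hasFDerivAt
    (tendsto_id.mono_right nhdsWithin_le_nhds)).congr' ?_ .rfl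
  filter_upwards [hV] with s ⟨_, _, end_eq, _⟩
  have end_value : chartCoframe p (V s 1).proj (V s 1).snd = h s v := by
    rw [end_eq]
    exact chartCoframe_self p _
  rw [end_value, neg_div, neg_smul, smul_neg, sub_neg_eq_add]
  rfl

end ChartLoop

theorem tendsto_trivializationAt {B F : Type*} [TopologicalSpace B] [TopologicalSpace F]
    {E : B → Type*} [TopologicalSpace (TotalSpace F E)] [∀ x, TopologicalSpace (E x)]
    [FiberBundle F E] {ι : Type*} {l : Filter ι} {f : ι → TotalSpace F E} {z : TotalSpace F E}
    (hf : Tendsto f l (𝓝 z)) :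
    Tendsto (fun i => (trivializationAt F E z.proj (f i)).2) l
      (𝓝 (trivializationAt F E z.proj z).2) :=
  (continuous_snd.tendsto _).comp <| ((trivializationAt F E z.proj).continuousAt
    FiberBundle.mem_trivializationAt_proj_source).tendsto.comp hf

section Limits

variable {d : ℕ} {M : Type u} [TopologicalSpace M] [ChartedSpace (Euc d) M]
  [IsManifold (𝓡 d) ∞ M] {p : M}

theorem chartFrame_self (p : M) (v : Euc d) : chartFrame p p v = v := by
  rw [chartFrame, Trivialization.symmL_apply _ (FiberBundle.mem_baseSet_trivializationAt' p)]
  exact symm_trivializationAt_self p v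

theorem chartCoframe_comp_comp_chartFrame_pow {q : M}
    (hq : q ∈ (chartTriv (d := d) p).baseSet)
    {h : TangentSpace (𝓡 d) q →L[ℝ] TangentSpace (𝓡 d) q} {N : ℕ} (hN : h ^ N = 1) :
    (chartCoframe p q ∘L h ∘L chartFrame p q : Euc d →L[ℝ] Euc d) ^ N = 1 := by
  have semiconj : Function.Semiconj (chartFrame p q)
      (chartCoframe p q ∘L h ∘L chartFrame p q : Euc d →L[ℝ] Euc d) h :=
    fun v => chartFrame_chartCoframe hq _
  ext1 v
  rw [FunLike.coe_pow_eq_iterate, ← chartCoframe_chartFrame hq ((_ : Euc d → Euc d)^[N] v),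
    semiconj.iterate_right N v, ← FunLike.coe_pow_eq_iterate, hN]
  exact chartCoframe_chartFrame hq v

theorem pow_eq_one_of_tendsto {ι : Type*} {l : Filter ι} [l.NeBot] {N : ℕ} {q : ι → M}
    {h : (i : ι) → TangentSpace (𝓡 d) (q i) →L[ℝ] TangentSpace (𝓡 d) (q i)}
    {h' : TangentSpace (𝓡 d) p →L[ℝ] TangentSpace (𝓡 d) p}
    (hlim : Tendsto (fun i => (TotalSpace.mk' (Euc d →L[ℝ] Euc d) (q i) (h i) :
          TotalSpace (Euc d →L[ℝ] Euc d)
            (fun x : M => TangentSpace (𝓡 d) x →L[ℝ] TangentSpace (𝓡 d) x))) l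
        (𝓝 (TotalSpace.mk' (Euc d →L[ℝ] Euc d) p h')))
    (hN : ∀ᶠ i in l, h i ^ N = 1) : (h' : Euc d →L[ℝ] Euc d) ^ N = 1 := by
  have tendsto_base : Tendsto q l (𝓝 p) :=
    ((FiberBundle.continuous_proj (Euc d →L[ℝ] Euc d) _).tendsto _).comp hlim
  have tendsto_coordinates : Tendsto
      (fun i => (chartCoframe p (q i) ∘L h i ∘L chartFrame p (q i) : Euc d →L[ℝ] Euc d)) l
      (𝓝 (chartCoframe p p ∘L h' ∘L chartFrame p p)) :=
    tendsto_trivializationAt hlim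
  have coordinates_self :
      (chartCoframe p p ∘L h' ∘L chartFrame p p : Euc d →L[ℝ] Euc d) = h' := by
    ext1 v
    exact (chartCoframe_self p _).trans (congrArg h' (chartFrame_self p v))
  rw [coordinates_self] at tendsto_coordinates
  refine tendsto_nhds_unique (X := Euc d →L[ℝ] Euc d) (tendsto_coordinates.pow N)
    (tendsto_const_nhds.congr' ?_)
  filter_upwards [hN, tendsto_base.eventually (chartTriv_baseSet_mem_nhds (d := d) p)]
    with i pow_eq hq
  exact (chartCoframe_comp_comp_chartFrame_pow hq pow_eq).symm

theorem DefectBody.isParallelTransport_pow_eq_one {𝒲 : Archetype d} (h𝒲 : IsUndistorted 𝒲) {N : ℕ}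
    (hN : ∀ g ∈ symmetryGroup 𝒲, g ^ N = 1) (B : DefectBody.{u, w} M 𝒲)
    {D : Conn d M} (hD : B.IsLeviCivita D) {γ : ℝ → M} (hγ : IsClosedCurve d γ p)
    (hγB : MapsTo γ (Icc 0 1) B.carrier) {h : TangentSpace (𝓡 d) p →L[ℝ] TangentSpace (𝓡 d) p}
    (hh : IsParallelTransport D γ h) : h ^ N = 1 := by
  have hp : p ∈ B.carrier := hγ.1 ▸ hγB (left_mem_Icc.2 zero_le_one)
  obtain ⟨α, hα⟩ := mem_iUnion.1 (B.iUnion_U ▸ hp)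
  obtain ⟨g, hg, semiconj⟩ := B.exists_symmetry_of_isParallelTransport h𝒲 hD hγ hγB hh hα
  obtain ⟨e, he⟩ := B.P_invertible α p hα
  have semiconj_pow := Function.Semiconj.iterate_right semiconj N
  ext1 v
  refine e.injective ?_
  have conj_eq := semiconj_pow v
  rw [← FunLike.coe_pow_eq_iterate, ← FunLike.coe_pow_eq_iterate, ← Units.val_pow_eq_pow_val,
    hN g hg, ← he] at conj_eq
  exact conj_eq

theorem isFlat_of_forall_exists_pow_eq_one [T2Space M]
    {D : CovariantDerivative (𝓡 d) (Euc d) (TangentSpace (𝓡 d) : M → Type)}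
    (hD : CovariantDerivative.ContMDiffCovariantDerivative D ∞) {N : ℕ} (hN : N ≠ 0)
    (hol : ∀ (γ : ℝ → M) (p : M), IsClosedCurve d γ p →
      ∃ h : Euc d →L[ℝ] Euc d, h ^ N = 1 ∧ IsParallelTransport (d := d) (p := p) (q := p) D γ h) :
    IsFlat (d := d) (M := M) D := by
  intro X Y Z hX hY hZ p
  obtain ⟨h, hh⟩ := ((eventually_chartLoop_mem_target p (X p) (Y p)).mono
    fun s hs => hol _ p (isClosedCurve_chartLoop hs)).choice
  have expansion := isParallelTransport_chartLoop_isLittleO D.isCovariantDerivativeOnUniv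
    (differentiableAt_christoffel hD p) (hh.mono fun s hs => hs.2)
  have tendsto_sq_zero : Tendsto (fun s : ℝ => s ^ 2) (𝓝[>] 0) (𝓝 0) := by
    simpa using ((continuous_pow 2).tendsto (0 : ℝ)).mono_left nhdsWithin_le_nhds
  have tendsto_sq : Tendsto (fun s : ℝ => s ^ 2) (𝓝[>] 0) (𝓝[≠] 0) :=
    tendsto_nhdsWithin_iff.2 ⟨tendsto_sq_zero,
      eventually_mem_nhdsWithin.mono fun s hs => pow_ne_zero 2 (ne_of_gt hs)⟩
  have curvature_zero := (smul_eq_zero.1 (eq_zero_of_pow_eq_one_of_isLittleO hN tendsto_sq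
    (hh.mono fun s hs => hs.1) expansion)).resolve_left (by norm_num)
  exact (curvature_eq_curvatureForm hD hX hY hZ p).trans
    (congrArg (fun L : Euc d →L[ℝ] Euc d => L (Z p)) curvature_zero)

theorem isFlat_of_parallelTransportConverges [T2Space M] {𝒲 : Archetype d} (h𝒲 : IsUndistorted 𝒲)
    (hdisc : DiscreteTopology (symmetryGroup 𝒲)) {B : ℕ → DefectBody.{u, w} M 𝒲}
    {D : ℕ → Conn d M} (hB : ∀ n, (B n).IsLeviCivita (D n))
    {D' : CovariantDerivative (𝓡 d) (Euc d) (TangentSpace (𝓡 d) : M → Type)}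
    (hD' : CovariantDerivative.ContMDiffCovariantDerivative D' ∞)
    (hconv : ParallelTransportConverges (d := d) (fun n => (B n).carrier) D D') :
    IsFlat (d := d) (M := M) D' := by
  obtain ⟨N, N_ne_zero, hN⟩ := exists_pow_eq_one_of_isometry fun g hg => (h𝒲 g hg).1
  refine isFlat_of_forall_exists_pow_eq_one hD' N_ne_zero fun γ p hγ => ?_
  obtain ⟨h, γ', p', h', hh, hγ', -, hlim⟩ := hconv γ p hγ
  refine ⟨h, pow_eq_one_of_tendsto hlim (hγ'.mono fun n hn => ?_), hh⟩
  exact (B n).isParallelTransport_pow_eq_one h𝒲 hN (hB n) hn.1 hn.2.1 hn.2.2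

end Limits

end DiscreteDefects

open DiscreteDefects in
theorem mainTheorem3 {d : ℕ} (𝒲 : Archetype d) (h𝒲 : IsUndistorted 𝒲)
    (hdisc : DiscreteTopology (symmetryGroup 𝒲)) :
    (∃ ε : ℝ, 0 < ε ∧
      ∀ (M : Type u) [TopologicalSpace M] [T2Space M] [SecondCountableTopology M]
        [ChartedSpace (Euc d) M] [IsManifold (𝓡 d) ∞ M]
        (B : DefectBody.{u, w} M 𝒲) (γ : ℝ → M) (p : M)
        (c : TangentSpace (𝓡 d) p →L[ℝ] TangentSpace (𝓡 d) p),
        B.IsDisclinationContent γ c →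
          c = ContinuousLinearMap.id ℝ (TangentSpace (𝓡 d) p) ∨
          ∀ α : B.ι, p ∈ B.U α →
            ε ≤ ‖(B.P α p ∘L c ∘L (B.P α p).inverse) - ContinuousLinearMap.id ℝ (Euc d)‖) ∧
    (∀ (M : Type u) [TopologicalSpace M] [T2Space M] [SecondCountableTopology M]
        [ChartedSpace (Euc d) M] [IsManifold (𝓡 d) ∞ M]
        (Conv : (ℕ → DefectBody.{u, w} M 𝒲) → (ℕ → Conn d M) →
          CovariantDerivative (𝓡 d) (Euc d) (TangentSpace (𝓡 d) : M → Type) → Prop),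
        (∀ B D D', (∀ n, (B n).IsLeviCivita (D n)) →
          CovariantDerivative.ContMDiffCovariantDerivative D' ∞ → Conv B D D' →
          ParallelTransportConverges (fun n => (B n).carrier) D D') →
        ∀ (B : ℕ → DefectBody.{u, w} M 𝒲) (D : ℕ → Conn d M),
          (∀ n, (B n).IsLeviCivita (D n)) →
          ∀ D' : CovariantDerivative (𝓡 d) (Euc d) (TangentSpace (𝓡 d) : M → Type),
            CovariantDerivative.ContMDiffCovariantDerivative D' ∞ → ¬ IsFlat (d := d) (M := M) D' →
              ¬ Conv B D D') := by
  refine ⟨?_, ?_⟩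
  · obtain ⟨ε, hε, h⟩ := exists_disclination_gap.{u, w} h𝒲 hdisc
    exact ⟨ε, hε, fun M _ _ _ _ _ B γ p c hc => h M B γ p c hc⟩
  · intro M _ _ _ _ _ Conv hConv B D hB D' hD' hflat hC
    exact hflat (isFlat_of_parallelTransportConverges h𝒲 hdisc hB hD' (hConv B D D' hB hD' hC))
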